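/- Let $\mathbb K$ be a field of characteristic zero. A *G-algebra of Lie type* on generators $x_1,\dots,x_n$ is an algebra $$\mathbb K\langle x_1,\dots,x_n\mid x_jx_i=x_ix_j+d_{ij},\ 1\le i<j\le n\rangle ,$$ where the $d_{ij}\in\mathbb K[x_1,\dots,x_n]$ are read as combinations of standard monomials $x_1^{\alpha_1}\cdots x_n^{\alpha_n}$, such that (a) for all $i<j<k$ the expression $d_{ij}x_k-x_kd_{ij}+x_jd_{ik}-d_{ik}x_j+d_{jk}x_i-x_id_{jk}$ reduces to $0$ by finitely many replacements $x_jx_i\to x_ix_j+d_{ij}$ ($i<j$) in the free algebra, and (b) there is a monomial well-ordering $\prec$ with $\mathrm{lm}(d_{ij})\prec x_ix_j$ for all $i<j$; such an ordering is called compatible with the G-algebra structure. For algebras $A,B$ generated by $(x_i)$ and $(y_j)$ and a homomorphism $\phi:A\to B$, let $A\otimes^{\phi}B$ be the algebra generated by the $x_i$ and $y_j$ subject to the relations of $A$, the relations of $B$ and $y_jx_i-x_iy_j=y_j\phi(x_i)-\phi(x_i)y_j$; let $I_\phi\subset A\otimes^\phi B$ be the $(A,A)$-bimodule generated by the elements $x_i-\phi(x_i)$.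 Let $C$, $A_1$ (generators $x_i$), $B_1$ (generators $y_j$) be G-algebras of Lie type over $\mathbb K$, let $\varphi:A_1\to B_1$ be a homomorphism of $\mathbb K$-algebras, and put $$A=C\otimes A_1,\quad B=C\otimes B_1,\quad \phi=1_C\otimes\varphi,\quad E=A\otimes^{\phi}B,\quad E'=C\otimes(A_1\otimes^{\varphi}B_1).$$ There are canonical maps $A\to E'$, $B\to E'$, $A\to E$, $B\to E$, and two canonical maps $j_A,j_B:E'\to E$, which send $C$ to its copy in $A$, respectively in $B$, and agree with the canonical maps on $A_1$ and $B_1$. For a subset $S$ of a ring $R$, $RS$ denotes the left ideal generated by $S$, and intersections with $A$ or $E'$ mean preimages under the canonical maps. **Inclusions.** The composites $A\to E'\xrightarrow{j_A}E$ and $B\to E'\xrightarrow{j_B}E$ are the canonical maps, and $j_A$, $j_B$ are injective, so that $E'\subset E$. If $E'$ is a G-algebra of Lie type on the generators of $C$, $A_1$, $B_1$ (in this order) for some monomial well-ordering, then $A\to E'$ is injective, so that $A\subset E'\subset E$. Let $J\subset B$ be a left ideal. Then: 1. $(EI_\varphi+EJ)\cap E'=E'I_\varphi+E'J$, where $E'$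 is embedded into $E$ by $j_B$ (so that the image of $J$ under $B\to E'\to E$ is its image under $B\to E$); the same holds with $E'$ embedded by $j_A$ and $J$ embedded through $B\to E'\xrightarrow{j_A}E$. Moreover, with $J$ embedded through the canonical map $B\to E$, $(EI_\phi+EJ)\cap E'=E'I_\varphi+E'J$ for both embeddings of $E'$. 2. $\phi^{-1}(J)=(E'I_\varphi+E'J)\cap A$. The second intersection can be computed by Gröbner bases in $E'$, in the following sense. If a set $F$ generates the left ideal $J$, then $E'I_\varphi+E'J$ is the left ideal of $E'$ generated by the elements $x_i-\varphi(x_i)$ and $F$. Let $\prec$ be a monomial well-ordering which is compatible with a G-algebra structure of $E'$ on the generators of $C$, $A_1$, $B_1$ and is an elimination ordering for $B_1$ (each monomial involving a generator of $B_1$ is greater than each monomial in the generators of $C$ and $A_1$). Then $E'I_\varphi+E'J$ has a finite left Gröbner basis with respect to $\prec$, and for every left Gröbner basis $G$ of it, $G\cap A$ is a left Gröbner basis of $\phi^{-1}(J)$ with respect to the restriction of $\prec$, and generates the left ideal $\phi^{-1}(J)$ of $A$. Here a left Gröbner basis of a left ideal $L$ is a subset $G\subset L$ such that the leading monomial of each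 nonzero element of $L$ is divisible by the leading monomial of a nonzero element of $G$. -/

import Mathlib

open scoped TensorProduct MonomialOrder

noncomputable section

namespace GLie

/-! ### G-algebras of Lie type -/

/-- The standard monomial `∏ᵢ vᵢ ^ αᵢ`, the factors being multiplied in increasing order of `i`. -/
def stdMon {σ R : Type*} [Fintype σ] [LinearOrder σ] [Monoid R] (v : σ → R) (α : σ →₀ ℕ) : R :=
  (((Finset.univ : Finset σ).sort (· ≤ ·)).map fun i => v i ^ α i).prod

/-- A polynomial in commuting variables, read as the linear combination of the corresponding
standard monomials in the elements `v i` of an algebra. -/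
def stdEval {K σ R : Type*} [Fintype σ] [LinearOrder σ] [CommSemiring K] [Semiring R] [Algebra K R]
    (v : σ → R) (p : MvPolynomial σ K) : R :=
  ∑ α ∈ p.support, MvPolynomial.coeff α p • stdMon v α

section GAlgebra

variable {K σ : Type*} [Field K] [Fintype σ] [LinearOrder σ]

/-- The polynomial `d i j`, as an element of the free algebra. -/
abbrev freeD (d : σ → σ → MvPolynomial σ K) (i j : σ) : FreeAlgebra K σ :=
  stdEval (FreeAlgebra.ι K) (d i j)

/-- The relations `x_j x_i = x_i x_j + d_ij` for `i < j`. -/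
inductive GRel (d : σ → σ → MvPolynomial σ K) : FreeAlgebra K σ → FreeAlgebra K σ → Prop
  | comm (i j : σ) (h : i < j) :
      GRel d (FreeAlgebra.ι K j * FreeAlgebra.ι K i)
        (FreeAlgebra.ι K i * FreeAlgebra.ι K j + freeD d i j)

/-- The algebra `K⟨x_i | x_j x_i - x_i x_j - d_ij, i < j⟩`; only the `d i j` with `i < j` matter. -/
def GAlg (d : σ → σ → MvPolynomial σ K) : Type _ := RingQuot (GRel d)

instance (d : σ → σ → MvPolynomial σ K) : Ring (GAlg d) := inferInstanceAs (Ring (RingQuot _))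

instance (d : σ → σ → MvPolynomial σ K) : Algebra K (GAlg d) :=
  inferInstanceAs (Algebra K (RingQuot _))

/-- The projection of the free algebra onto `GAlg d`. -/
def GAlg.mk (d : σ → σ → MvPolynomial σ K) : FreeAlgebra K σ →ₐ[K] GAlg d :=
  RingQuot.mkAlgHom K (GRel d)

/-- The generators of `GAlg d`. -/
def GAlg.gen (d : σ → σ → MvPolynomial σ K) (i : σ) : GAlg d :=
  GAlg.mk d (FreeAlgebra.ι K i)

/-- The word `w`, as an element of the free algebra. -/
def word (w : List σ) : FreeAlgebra K σ := (w.map (FreeAlgebra.ι K)).prod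

/-- The coefficient of the word `w` in an element of the free algebra. -/
def wordCoeff (w : List σ) (p : FreeAlgebra K σ) : K :=
  (FreeAlgebra.equivMonoidAlgebraFreeMonoid p).coeff (FreeMonoid.ofList w)

/-- One reduction step: in `p` the word `u x_j x_i v` with `i < j` is replaced by
`u (x_i x_j + d_ij) v`. -/
def Step (d : σ → σ → MvPolynomial σ K) (p q : FreeAlgebra K σ) : Prop :=
  ∃ (u v : List σ) (i j : σ), i < j ∧
    q = p - wordCoeff (u ++ [j, i] ++ v) p •
      (word u * (FreeAlgebra.ι K j * FreeAlgebra.ι K i - FreeAlgebra.ι K i * FreeAlgebra.ι K j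
        - freeD d i j) * word v)

/-- The non-degeneracy conditions: for `i < j < k` the expression below reduces to zero by
finitely many reduction steps. -/
def Nondegenerate (d : σ → σ → MvPolynomial σ K) : Prop :=
  ∀ i j k : σ, i < j → j < k →
    Relation.ReflTransGen (Step d)
      (freeD d i j * FreeAlgebra.ι K k - FreeAlgebra.ι K k * freeD d i j
        + FreeAlgebra.ι K j * freeD d i k - freeD d i k * FreeAlgebra.ι K j
        + freeD d j k * FreeAlgebra.ι K i - FreeAlgebra.ι K i * freeD d j k) 0

end GAlgebra

section Orders

variable {K : Type*} {σ : Type} [Field K] [Fintype σ] [LinearOrder σ]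

/-- The `d_ij` define a G-algebra of Lie type, with `m` as an admissible monomial (well-)ordering:
`lm(d_ij) ≺ x_i x_j`. For `d_ij = 0` this holds, the degree of `0` being `0`. -/
def IsGAlgebraFor (m : MonomialOrder.{0, 0} σ) (d : σ → σ → MvPolynomial σ K) : Prop :=
  Nondegenerate d ∧
    ∀ i j : σ, i < j → m.degree (d i j) ≺[m] Finsupp.single i 1 + Finsupp.single j 1

/-- The `d_ij` define a G-algebra of Lie type. -/
def IsGAlgebra (d : σ → σ → MvPolynomial σ K) : Prop :=
  ∃ m : MonomialOrder.{0, 0} σ, IsGAlgebraFor m d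

/-- The algebra `R` is a G-algebra of Lie type on the generators `v i`, and the monomial ordering
`m` is compatible with this structure. -/
def IsGAlgebraOn {R : Type*} [Ring R] [Algebra K R] (m : MonomialOrder.{0, 0} σ) (v : σ → R) :
    Prop :=
  ∃ d : σ → σ → MvPolynomial σ K, IsGAlgebraFor m d ∧
    ∃ e : GAlg d ≃ₐ[K] R, ∀ i, e (GAlg.gen d i) = v i

/-- `G` is a left Gröbner basis of the left ideal `L`, in an algebra `R` whose elements are
written in terms of standard monomials in the `v i`: `G ⊆ L`, and the leading monomial of every
nonzero element of `L` is divisible by the leading monomial of a nonzero element of `G`. -/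
def IsLeftGroebnerBasis (K : Type*) [Field K] {R : Type*} [Ring R] [Algebra K R]
    (m : MonomialOrder.{0, 0} σ) (v : σ → R) (L : Ideal R) (G : Set R) : Prop :=
  G ⊆ L ∧ ∀ p : MvPolynomial σ K, p ≠ 0 → stdEval v p ∈ L →
    ∃ q : MvPolynomial σ K, q ≠ 0 ∧ stdEval v q ∈ G ∧ m.degree q ≤ m.degree p

end Orders

/-- The monomials in the variables `α`, as elements of the ordered monoid of all monomials. -/
def restrictHom {α β : Type} (m : MonomialOrder.{0, 0} (α ⊕ₗ β)) : (α →₀ ℕ) →+ m.syn :=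
  m.toSyn.toAddMonoidHom.comp (Finsupp.mapDomain.addMonoidHom Sum.inlₗ)

theorem restrictHom_injective {α β : Type} (m : MonomialOrder.{0, 0} (α ⊕ₗ β)) :
    Function.Injective (restrictHom m) :=
  m.toSyn.injective.comp (Finsupp.mapDomain_injective (toLex.injective.comp Sum.inl_injective))

/-- The restriction of a monomial ordering on the variables `α ⊕ β` to the monomials in the
variables `α`. -/
def restrictLeft {α β : Type} (m : MonomialOrder.{0, 0} (α ⊕ₗ β)) : MonomialOrder.{0, 0} α where
  syn := AddMonoidHom.mrange (restrictHom m)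
  addCommMonoidSyn := AddSubmonoid.toAddCommMonoid _
  toSyn :=
    { Equiv.ofBijective (restrictHom m).mrangeRestrict
        ⟨fun _ _ h => restrictHom_injective m (congrArg Subtype.val h),
          (restrictHom m).mrangeRestrict_surjective⟩ with
      map_add' := fun a b => Subtype.ext (map_add (restrictHom m) a b) }
  toSyn_monotone := fun a b h => by
    change restrictHom m a ≤ restrictHom m b
    obtain ⟨c, rfl⟩ := exists_add_of_le h
    rw [map_add]
    exact le_add_of_nonneg_right (m.zero_le _)
  wellFoundedLT_syn := ⟨InvImage.wf Subtype.val (wellFounded_lt (α := m.syn))⟩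

theorem restrictLeft_lt_iff {α β : Type} (m : MonomialOrder.{0, 0} (α ⊕ₗ β)) (a b : α →₀ ℕ) :
    a ≺[restrictLeft m] b ↔ a.mapDomain Sum.inlₗ ≺[m] b.mapDomain Sum.inlₗ := by
  rfl

/-- `m` is an elimination ordering for the variables `β`: a monomial in which a variable of `β`
occurs is greater than every monomial in the variables `α` alone. -/
def IsEliminationOrder {α β : Type} (m : MonomialOrder.{0, 0} (α ⊕ₗ β)) : Prop :=
  ∀ a b : (α ⊕ₗ β) →₀ ℕ, (∀ j : β, a (Sum.inrₗ j) = 0) → (∃ j : β, b (Sum.inrₗ j) ≠ 0) →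
    a ≺[m] b

/-! ### The algebra `A ⊗^φ B` -/

section Twisted

variable {K A B ι κ : Type*} [Field K] [Ring A] [Algebra K A] [Ring B] [Algebra K B]

/-- The relations of `A ⊗^φ B` on the set of generators `A ⊕ B`: those which hold in `A`, those
which hold in `B`, and `y_j x_i - x_i y_j = y_j φ(x_i) - φ(x_i) y_j`. -/
inductive TwRel (φ : A →ₐ[K] B) (x : ι → A) (y : κ → B) :
    FreeAlgebra K (A ⊕ B) → FreeAlgebra K (A ⊕ B) → Prop
  | left_add (a a' : A) : TwRel φ x y (FreeAlgebra.ι K (Sum.inl (a + a')))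
      (FreeAlgebra.ι K (Sum.inl a) + FreeAlgebra.ι K (Sum.inl a'))
  | left_mul (a a' : A) : TwRel φ x y (FreeAlgebra.ι K (Sum.inl (a * a')))
      (FreeAlgebra.ι K (Sum.inl a) * FreeAlgebra.ι K (Sum.inl a'))
  | left_algebraMap (c : K) : TwRel φ x y (FreeAlgebra.ι K (Sum.inl (algebraMap K A c)))
      (algebraMap K _ c)
  | right_add (b b' : B) : TwRel φ x y (FreeAlgebra.ι K (Sum.inr (b + b')))
      (FreeAlgebra.ι K (Sum.inr b) + FreeAlgebra.ι K (Sum.inr b'))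
  | right_mul (b b' : B) : TwRel φ x y (FreeAlgebra.ι K (Sum.inr (b * b')))
      (FreeAlgebra.ι K (Sum.inr b) * FreeAlgebra.ι K (Sum.inr b'))
  | right_algebraMap (c : K) : TwRel φ x y (FreeAlgebra.ι K (Sum.inr (algebraMap K B c)))
      (algebraMap K _ c)
  | cross (i : ι) (j : κ) : TwRel φ x y
      (FreeAlgebra.ι K (Sum.inr (y j)) * FreeAlgebra.ι K (Sum.inl (x i))
        - FreeAlgebra.ι K (Sum.inl (x i)) * FreeAlgebra.ι K (Sum.inr (y j)))
      (FreeAlgebra.ι K (Sum.inr (y j)) * FreeAlgebra.ι K (Sum.inr (φ (x i)))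
        - FreeAlgebra.ι K (Sum.inr (φ (x i))) * FreeAlgebra.ι K (Sum.inr (y j)))

/-- `A ⊗^φ B`, for algebras `A` and `B` generated by the families `x` and `y`: the free product of
`A` and `B` modulo the relations `y_j x_i - x_i y_j = y_j φ(x_i) - φ(x_i) y_j`. In other words, the
algebra generated by the `x_i` and the `y_j` subject to the relations of `A`, those of `B`, and
these. -/
def Tw (φ : A →ₐ[K] B) (x : ι → A) (y : κ → B) : Type _ := RingQuot (TwRel φ x y)

variable (φ : A →ₐ[K] B) (x : ι → A) (y : κ → B)

instance : Ring (Tw φ x y) := inferInstanceAs (Ring (RingQuot _))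

instance : Algebra K (Tw φ x y) := inferInstanceAs (Algebra K (RingQuot _))

/-- The projection of the free algebra onto `A ⊗^φ B`. -/
def Tw.mk : FreeAlgebra K (A ⊕ B) →ₐ[K] Tw φ x y := RingQuot.mkAlgHom K (TwRel φ x y)

variable {φ x y} in
theorem Tw.mk_rel {p q : FreeAlgebra K (A ⊕ B)} (h : TwRel φ x y p q) :
    Tw.mk φ x y p = Tw.mk φ x y q := RingQuot.mkAlgHom_rel K h

/-- The canonical map `A → A ⊗^φ B`. -/
def Tw.inA : A →ₐ[K] Tw φ x y :=
  AlgHom.ofLinearMap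
    { toFun := fun a => Tw.mk φ x y (FreeAlgebra.ι K (Sum.inl a))
      map_add' := fun a a' => by rw [Tw.mk_rel (.left_add a a'), map_add]
      map_smul' := fun c a => by
        rw [Algebra.smul_def, Tw.mk_rel (.left_mul _ a), map_mul, Tw.mk_rel (.left_algebraMap c),
          AlgHom.commutes, ← Algebra.smul_def, RingHom.id_apply] }
    (by
      change Tw.mk φ x y (FreeAlgebra.ι K (Sum.inl 1)) = 1
      rw [← map_one (algebraMap K A), Tw.mk_rel (.left_algebraMap 1), map_one, map_one])
    (fun a a' => by
      change Tw.mk φ x y (FreeAlgebra.ι K (Sum.inl (a * a'))) = _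
      rw [Tw.mk_rel (.left_mul a a'), map_mul]; rfl)

/-- The canonical map `B → A ⊗^φ B`. -/
def Tw.inB : B →ₐ[K] Tw φ x y :=
  AlgHom.ofLinearMap
    { toFun := fun b => Tw.mk φ x y (FreeAlgebra.ι K (Sum.inr b))
      map_add' := fun b b' => by rw [Tw.mk_rel (.right_add b b'), map_add]
      map_smul' := fun c b => by
        rw [Algebra.smul_def, Tw.mk_rel (.right_mul _ b), map_mul,
          Tw.mk_rel (.right_algebraMap c),
          AlgHom.commutes, ← Algebra.smul_def, RingHom.id_apply] }
    (by
      change Tw.mk φ x y (FreeAlgebra.ι K (Sum.inr 1)) = 1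
      rw [← map_one (algebraMap K B), Tw.mk_rel (.right_algebraMap 1), map_one, map_one])
    (fun b b' => by
      change Tw.mk φ x y (FreeAlgebra.ι K (Sum.inr (b * b'))) = _
      rw [Tw.mk_rel (.right_mul b b'), map_mul]; rfl)

theorem Tw.cross (i : ι) (j : κ) :
    Tw.inB φ x y (y j) * Tw.inA φ x y (x i) - Tw.inA φ x y (x i) * Tw.inB φ x y (y j) =
      Tw.inB φ x y (y j) * Tw.inB φ x y (φ (x i))
        - Tw.inB φ x y (φ (x i)) * Tw.inB φ x y (y j) := by
  have h := Tw.mk_rel (TwRel.cross (φ := φ) (x := x) (y := y) i j)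
  rw [map_sub, map_sub, map_mul, map_mul, map_mul, map_mul] at h
  exact h

/-- The `(A, A)`-bimodule `I_φ ⊆ A ⊗^φ B` generated by the elements `x_i - φ(x_i)`. -/
def twI : Submodule K (Tw φ x y) :=
  Submodule.span K {z | ∃ (a a' : A) (i : ι),
    z = Tw.inA φ x y a * (Tw.inA φ x y (x i) - Tw.inB φ x y (φ (x i))) * Tw.inA φ x y a'}

variable {φ x y}

/-- The universal property of `A ⊗^φ B`. -/
def Tw.lift {R : Type*} [Ring R] [Algebra K R] (f : A →ₐ[K] R) (g : B →ₐ[K] R)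
    (h : ∀ i j, g (y j) * f (x i) - f (x i) * g (y j) =
      g (y j) * g (φ (x i)) - g (φ (x i)) * g (y j)) : Tw φ x y →ₐ[K] R :=
  RingQuot.liftAlgHom K ⟨FreeAlgebra.lift K (Sum.elim f g), fun p q hpq => by
    cases hpq <;> simp [h]⟩

@[simp] theorem Tw.lift_inA {R : Type*} [Ring R] [Algebra K R] (f : A →ₐ[K] R) (g : B →ₐ[K] R)
    (h : ∀ i j, g (y j) * f (x i) - f (x i) * g (y j) =
      g (y j) * g (φ (x i)) - g (φ (x i)) * g (y j)) (a : A) :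
    Tw.lift f g h (Tw.inA φ x y a) = f a := by
  refine (RingQuot.liftAlgHom_mkAlgHom_apply K _ _ _).trans ?_
  simp

@[simp] theorem Tw.lift_inB {R : Type*} [Ring R] [Algebra K R] (f : A →ₐ[K] R) (g : B →ₐ[K] R)
    (h : ∀ i j, g (y j) * f (x i) - f (x i) * g (y j) =
      g (y j) * g (φ (x i)) - g (φ (x i)) * g (y j)) (b : B) :
    Tw.lift f g h (Tw.inB φ x y b) = g b := by
  refine (RingQuot.liftAlgHom_mkAlgHom_apply K _ _ _).trans ?_
  simp

/-- A homomorphism out of `A ⊗^φ B` has its values in a subalgebra, once it does so on `A` and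
on `B`. -/
theorem Tw.map_mem {R : Type*} [Ring R] [Algebra K R] (f : Tw φ x y →ₐ[K] R) (S : Subalgebra K R)
    (hA : ∀ a, f (Tw.inA φ x y a) ∈ S) (hB : ∀ b, f (Tw.inB φ x y b) ∈ S) (w : Tw φ x y) :
    f w ∈ S := by
  obtain ⟨p, rfl⟩ : ∃ p, Tw.mk φ x y p = w := RingQuot.mkAlgHom_surjective K (TwRel φ x y) w
  induction p using FreeAlgebra.induction with
  | grade0 c =>
    rw [AlgHom.commutes, AlgHom.commutes]
    exact S.algebraMap_mem c
  | grade1 s =>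
    cases s with
    | inl a => exact hA a
    | inr b => exact hB b
  | mul a b ha hb => rw [map_mul, map_mul]; exact S.mul_mem ha hb
  | add a b ha hb => rw [map_add, map_add]; exact S.add_mem ha hb

end Twisted

/-- A homomorphism out of `GAlg d` has its values in a subalgebra, once it does so on the
generators. -/
theorem GAlg.map_mem {K σ : Type*} [Field K] [Fintype σ] [LinearOrder σ]
    {d : σ → σ → MvPolynomial σ K} {R : Type*} [Ring R] [Algebra K R] (f : GAlg d →ₐ[K] R)
    (S : Subalgebra K R) (h : ∀ i, f (GAlg.gen d i) ∈ S) (w : GAlg d) : f w ∈ S := by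
  obtain ⟨p, rfl⟩ : ∃ p, GAlg.mk d p = w := RingQuot.mkAlgHom_surjective K (GRel d) w
  induction p using FreeAlgebra.induction with
  | grade0 c =>
    rw [AlgHom.commutes, AlgHom.commutes]
    exact S.algebraMap_mem c
  | grade1 s => exact h s
  | mul a b ha hb => rw [map_mul, map_mul]; exact S.mul_mem ha hb
  | add a b ha hb => rw [map_add, map_add]; exact S.add_mem ha hb

/-! ### The data of the theorem -/

section Data

variable {K : Type*} [Field K] {r n k : ℕ}
  (dC : Fin r → Fin r → MvPolynomial (Fin r) K)
  {dA : Fin n → Fin n → MvPolynomial (Fin n) K}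
  {dB : Fin k → Fin k → MvPolynomial (Fin k) K}
  (φ₁ : GAlg dA →ₐ[K] GAlg dB)

/-- The generators `c_l ⊗ 1`, `1 ⊗ x_i` of `C ⊗ A₁`. -/
def tgen (dA : Fin n → Fin n → MvPolynomial (Fin n) K) (s : Fin r ⊕ₗ Fin n) :
    GAlg dC ⊗[K] GAlg dA :=
  Sum.elim (fun l => GAlg.gen dC l ⊗ₜ[K] 1) (fun i => 1 ⊗ₜ[K] GAlg.gen dA i) (ofLex s)

/-- `φ = 1_C ⊗ φ₁ : A = C ⊗ A₁ → B = C ⊗ B₁`. -/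
def bigHom : GAlg dC ⊗[K] GAlg dA →ₐ[K] GAlg dC ⊗[K] GAlg dB :=
  Algebra.TensorProduct.map (AlgHom.id K (GAlg dC)) φ₁

/-- `A₁ ⊗^{φ₁} B₁`. -/
abbrev Tw₁ : Type _ := Tw φ₁ (GAlg.gen dA) (GAlg.gen dB)

/-- `E = A ⊗^φ B`. -/
abbrev BigE : Type _ := Tw (bigHom dC φ₁) (tgen dC dA) (tgen dC dB)

/-- `E' = C ⊗ (A₁ ⊗^{φ₁} B₁)`. -/
abbrev SmallE : Type _ := GAlg dC ⊗[K] Tw₁ φ₁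

/-- The canonical map `A → E'`. -/
def inA' : GAlg dC ⊗[K] GAlg dA →ₐ[K] SmallE dC φ₁ :=
  Algebra.TensorProduct.map (AlgHom.id K (GAlg dC)) (Tw.inA φ₁ _ _)

/-- The canonical map `B → E'`. -/
def inB' : GAlg dC ⊗[K] GAlg dB →ₐ[K] SmallE dC φ₁ :=
  Algebra.TensorProduct.map (AlgHom.id K (GAlg dC)) (Tw.inB φ₁ _ _)

/-- The canonical map `A → E`. -/
def inA : GAlg dC ⊗[K] GAlg dA →ₐ[K] BigE dC φ₁ := Tw.inA _ _ _

/-- The canonical map `B → E`. -/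
def inB : GAlg dC ⊗[K] GAlg dB →ₐ[K] BigE dC φ₁ := Tw.inB _ _ _

/-- The generators of `E'`: those of `C`, those of `A₁`, those of `B₁`. -/
def genE' (s : (Fin r ⊕ₗ Fin n) ⊕ₗ Fin k) : SmallE dC φ₁ :=
  Sum.elim (fun t => inA' dC φ₁ (tgen dC dA t))
    (fun j => inB' dC φ₁ (1 ⊗ₜ[K] GAlg.gen dB j)) (ofLex s)

theorem cross_inA_inB (c c' : GAlg dC) (a : GAlg dA) (b : GAlg dB)
    (ha : ∃ s, tgen dC dA s = c ⊗ₜ a) (hb : ∃ t, tgen dC dB t = c' ⊗ₜ b) :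
    inB dC φ₁ (c' ⊗ₜ b) * inA dC φ₁ (c ⊗ₜ a) - inA dC φ₁ (c ⊗ₜ a) * inB dC φ₁ (c' ⊗ₜ b) =
      inB dC φ₁ ((c' * c) ⊗ₜ (b * φ₁ a)) - inB dC φ₁ ((c * c') ⊗ₜ (φ₁ a * b)) := by
  obtain ⟨s, hs⟩ := ha
  obtain ⟨t, ht⟩ := hb
  have h := Tw.cross (bigHom dC φ₁) (tgen dC dA) (tgen dC dB) s t
  have hφ : bigHom dC φ₁ (c ⊗ₜ a) = c ⊗ₜ φ₁ a := rfl
  rw [hs, ht, hφ, ← map_mul, ← map_mul, Algebra.TensorProduct.tmul_mul_tmul,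
    Algebra.TensorProduct.tmul_mul_tmul] at h
  exact h

/-- The canonical map `A₁ ⊗^{φ₁} B₁ → E`. -/
def tw₁ToE : Tw₁ φ₁ →ₐ[K] BigE dC φ₁ :=
  Tw.lift ((inA dC φ₁).comp Algebra.TensorProduct.includeRight)
    ((inB dC φ₁).comp Algebra.TensorProduct.includeRight) (fun i j => by
      have h := cross_inA_inB dC φ₁ 1 1 (GAlg.gen dA i) (GAlg.gen dB j)
        ⟨Sum.inrₗ i, rfl⟩ ⟨Sum.inrₗ j, rfl⟩
      simp only [AlgHom.comp_apply, Algebra.TensorProduct.includeRight_apply]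
      rw [h, ← map_mul, ← map_mul, Algebra.TensorProduct.tmul_mul_tmul,
        Algebra.TensorProduct.tmul_mul_tmul])

theorem tw₁ToE_inA (a : GAlg dA) :
    tw₁ToE dC φ₁ (Tw.inA φ₁ _ _ a) = inA dC φ₁ (1 ⊗ₜ a) := by
  simp [tw₁ToE]

theorem tw₁ToE_inB (b : GAlg dB) :
    tw₁ToE dC φ₁ (Tw.inB φ₁ _ _ b) = inB dC φ₁ (1 ⊗ₜ b) := by
  simp [tw₁ToE]

theorem commute_tmul {dD : Fin k → Fin k → MvPolynomial (Fin k) K} {R : Type*} [Ring R] [Algebra K R]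
    (f : GAlg dC ⊗[K] GAlg dD →ₐ[K] R) (c : GAlg dC) (a : GAlg dD) :
    Commute (f (c ⊗ₜ 1)) (f (1 ⊗ₜ a)) := by
  simp [Commute, SemiconjBy, ← map_mul]

/-- Two homomorphisms have commuting values, once they do so on generators. -/
theorem commute_of_gen (f : GAlg dC →ₐ[K] BigE dC φ₁)
    (hA : ∀ l i, Commute (f (GAlg.gen dC l)) (inA dC φ₁ (1 ⊗ₜ GAlg.gen dA i)))
    (hB : ∀ l j, Commute (f (GAlg.gen dC l)) (inB dC φ₁ (1 ⊗ₜ GAlg.gen dB j)))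
    (c : GAlg dC) (w : Tw₁ φ₁) : Commute (f c) (tw₁ToE dC φ₁ w) := by
  have key : ∀ l, tw₁ToE dC φ₁ w ∈ Subalgebra.centralizer K {f (GAlg.gen dC l)} := by
    intro l
    refine Tw.map_mem _ _ (fun a => ?_) (fun b => ?_) w
    · refine GAlg.map_mem ((tw₁ToE dC φ₁).comp (Tw.inA φ₁ _ _)) _ (fun i => ?_) a
      rw [Subalgebra.mem_centralizer_iff]
      rintro _ rfl
      rw [AlgHom.comp_apply, tw₁ToE_inA]
      exact hA l i
    · refine GAlg.map_mem ((tw₁ToE dC φ₁).comp (Tw.inB φ₁ _ _)) _ (fun j => ?_) b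
      rw [Subalgebra.mem_centralizer_iff]
      rintro _ rfl
      rw [AlgHom.comp_apply, tw₁ToE_inB]
      exact hB l j
  have hc : f c ∈ Subalgebra.centralizer K {tw₁ToE dC φ₁ w} := by
    refine GAlg.map_mem _ _ (fun l => ?_) c
    rw [Subalgebra.mem_centralizer_iff]
    rintro _ rfl
    exact ((Subalgebra.mem_centralizer_iff K).mp (key l) _ rfl).symm
  exact ((Subalgebra.mem_centralizer_iff K).mp hc _ rfl).symm

theorem commute_left (c : GAlg dC) (w : Tw₁ φ₁) :
    Commute ((inA dC φ₁).comp Algebra.TensorProduct.includeLeft c) (tw₁ToE dC φ₁ w) := by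
  refine commute_of_gen dC φ₁ _ (fun l i => commute_tmul dC (inA dC φ₁) _ _) (fun l j => ?_) c w
  have h := cross_inA_inB dC φ₁ (GAlg.gen dC l) 1 1 (GAlg.gen dB j)
    ⟨Sum.inlₗ l, rfl⟩ ⟨Sum.inrₗ j, rfl⟩
  rw [map_one, one_mul, mul_one, one_mul, mul_one, sub_self] at h
  exact (sub_eq_zero.mp h).symm

theorem commute_right (c : GAlg dC) (w : Tw₁ φ₁) :
    Commute ((inB dC φ₁).comp Algebra.TensorProduct.includeLeft c) (tw₁ToE dC φ₁ w) := by
  refine commute_of_gen dC φ₁ _ (fun l i => ?_) (fun l j => commute_tmul dC (inB dC φ₁) _ _) c w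
  have h := cross_inA_inB dC φ₁ 1 (GAlg.gen dC l) (GAlg.gen dA i) 1
    ⟨Sum.inrₗ i, rfl⟩ ⟨Sum.inlₗ l, rfl⟩
  rw [one_mul, mul_one, one_mul, mul_one, sub_self] at h
  exact sub_eq_zero.mp h

/-- The canonical map `E' → E` which sends `C` to the copy of `C` in `A`. -/
def jA : SmallE dC φ₁ →ₐ[K] BigE dC φ₁ :=
  Algebra.TensorProduct.lift ((inA dC φ₁).comp Algebra.TensorProduct.includeLeft) (tw₁ToE dC φ₁)
    (commute_left dC φ₁)

/-- The canonical map `E' → E` which sends `C` to the copy of `C` in `B`. -/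
def jB : SmallE dC φ₁ →ₐ[K] BigE dC φ₁ :=
  Algebra.TensorProduct.lift ((inB dC φ₁).comp Algebra.TensorProduct.includeLeft) (tw₁ToE dC φ₁)
    (commute_right dC φ₁)

/-- The bimodule `I_{φ₁} ⊆ A₁ ⊗^{φ₁} B₁`, as a subset of `E'`. -/
def smallI : Set (SmallE dC φ₁) :=
  (fun w => (1 : GAlg dC) ⊗ₜ[K] w) '' (twI φ₁ (GAlg.gen dA) (GAlg.gen dB) : Set (Tw₁ φ₁))

/-- The bimodule `I_φ ⊆ A ⊗^φ B = E`. -/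
def bigI : Set (BigE dC φ₁) := twI (bigHom dC φ₁) (tgen dC dA) (tgen dC dB)

/-- The left ideal `E' I_{φ₁} + E' J` of `E'`. -/
def smallIdeal (J : Ideal (GAlg dC ⊗[K] GAlg dB)) : Ideal (SmallE dC φ₁) :=
  Ideal.span (smallI dC φ₁) ⊔ Ideal.span (inB' dC φ₁ '' J)

end Data

end GLie

end

/-! The whole theorem rests on one retraction. The homomorphism `ρ : A ⊗^φ B → B` which is `φ` on
`A` and the identity on `B` is well defined, since it turns the cross relations into identities.
These relations say exactly that every `y_j` commutes with `x_i - φ(x_i)`, so all of `B` does. Hence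
the left ideal generated by the `x_i - φ(x_i)` is already two-sided, and modulo it every `t` is
equal to `ρ(t) ∈ B`: it is the kernel of `ρ`. Adding a left ideal `J` of `B` yields `ρ⁻¹(J)`
(`Tw.span_twI_sup_span`).

The same holds in `E'` with `ρ' = 1_C ⊗ ρ` (`smallIdeal_eq`). Since `ρ ∘ j_A = ρ ∘ j_B = ρ'`, the
ideals built from `I_φ` in `E` contract to `ρ'⁻¹(J)`; since `ρ'` restricts to `φ` on `A`, so does
the second identity. For the ideals built from `I_φ₁`, and for injectivity of `j_A` and `j_B`, a
homomorphism `E → E'` that is left inverse to both embeddings is used (`bigToSmall`).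

Injectivity of `A → E'` needs linear independence of standard monomials in a G-algebra
(`stdEval_gen_eq_zero`). This is a diamond lemma: a normal form map on the free algebra is defined
by well-founded recursion on words, and non-degeneracy makes it vanish on the defining relations.
Standard monomials span `A` and go to standard monomials of `E'`, so the map is injective.

For Gröbner bases, finiteness is Dickson's lemma. With an elimination ordering, an element whose
leading monomial avoids the generators of `B₁` avoids them altogether. This gives the
leading-monomial property of `G ∩ A`, and also shows that the commutation relations of `A` are
compatible with the restricted ordering, so that division with remainder proves that `G ∩ A`
generates. -/

namespace GLie

/-! ### Left ideals of `A ⊗^φ B` and the retraction onto `B`. -/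

section TwistedIdeals

variable {K A B ι κ : Type*} [Field K] [Ring A] [Algebra K A] [Ring B] [Algebra K B]
  (φ : A →ₐ[K] B) (x : ι → A) (y : κ → B)

/-- The homomorphism `A ⊗^φ B → B` which is `φ` on `A` and the identity on `B`. -/
noncomputable def Tw.retract : Tw φ x y →ₐ[K] B :=
  Tw.lift φ (AlgHom.id K B) (fun _ _ => rfl)

@[simp] theorem Tw.retract_inA (a : A) : Tw.retract φ x y (Tw.inA φ x y a) = φ a :=
  Tw.lift_inA _ _ _ _

@[simp] theorem Tw.retract_inB (b : B) : Tw.retract φ x y (Tw.inB φ x y b) = b :=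
  Tw.lift_inB _ _ _ _

/-- The element `x_i - φ(x_i)` of `A ⊗^φ B`. -/
noncomputable def Tw.diff (i : ι) : Tw φ x y := Tw.inA φ x y (x i) - Tw.inB φ x y (φ (x i))

theorem Tw.retract_diff (i : ι) : Tw.retract φ x y (Tw.diff φ x y i) = 0 := by
  simp [Tw.diff]

variable {x y}

/-- For `b = y_j` this is the cross relation with its terms rearranged; the elements commuting with
a fixed one form a subalgebra. -/
theorem Tw.commute_diff (hy : Algebra.adjoin K (Set.range y) = ⊤) (i : ι) (b : B) :
    Tw.inB φ x y b * Tw.diff φ x y i = Tw.diff φ x y i * Tw.inB φ x y b := by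
  have hb : b ∈ Algebra.adjoin K (Set.range y) := hy ▸ Algebra.mem_top
  induction hb using Algebra.adjoin_induction with
  | mem b h =>
    obtain ⟨j, rfl⟩ := h
    have h := Tw.cross φ x y i j
    rw [sub_eq_sub_iff_add_eq_add] at h
    rw [Tw.diff, mul_sub, sub_mul, sub_eq_sub_iff_add_eq_add, h, add_comm]
  | algebraMap c => rw [AlgHom.commutes, Algebra.commutes]
  | add a b _ _ ha hb => rw [map_add, add_mul, mul_add, ha, hb]
  | mul a b _ _ ha hb => rw [map_mul, mul_assoc, hb, ← mul_assoc, ha, mul_assoc]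

/-- Right multiplication by `B` is harmless because `B` commutes with the generators of the ideal.
Right multiplication by `x_i` then follows from `x_i = (x_i - φ(x_i)) + φ(x_i)`: the first summand
lies in the left ideal and the second in `B`. -/
theorem Tw.span_diff_mul_mem (hx : Algebra.adjoin K (Set.range x) = ⊤)
    (hy : Algebra.adjoin K (Set.range y) = ⊤) (t l : Tw φ x y)
    (hl : l ∈ Ideal.span (Set.range (Tw.diff φ x y))) :
    l * t ∈ Ideal.span (Set.range (Tw.diff φ x y)) := by
  have hB : ∀ (b : B) (l : Tw φ x y), l ∈ Ideal.span (Set.range (Tw.diff φ x y)) →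
      l * Tw.inB φ x y b ∈ Ideal.span (Set.range (Tw.diff φ x y)) := by
    intro b l hl
    induction hl using Submodule.span_induction with
    | mem l h =>
      obtain ⟨i, rfl⟩ := h
      rw [← Tw.commute_diff φ hy]
      exact Ideal.mul_mem_left _ _ (Ideal.subset_span ⟨i, rfl⟩)
    | zero => rw [zero_mul]; exact Submodule.zero_mem _
    | add a b _ _ ha hb => rw [add_mul]; exact Submodule.add_mem _ ha hb
    | smul c l _ h => rw [smul_eq_mul, mul_assoc]; exact Ideal.mul_mem_left _ _ h
  let S : Subalgebra K (Tw φ x y) :=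
    { carrier := {t | ∀ l ∈ Ideal.span (Set.range (Tw.diff φ x y)),
        l * t ∈ Ideal.span (Set.range (Tw.diff φ x y))}
      mul_mem' := fun {a b} ha hb l hl => by rw [← mul_assoc]; exact hb _ (ha _ hl)
      add_mem' := fun {a b} ha hb l hl => by
        rw [mul_add]; exact Submodule.add_mem _ (ha _ hl) (hb _ hl)
      algebraMap_mem' := fun c l hl => by
        rw [← Algebra.commutes]; exact Ideal.mul_mem_left _ _ hl }
  have hA : Algebra.adjoin K (Set.range x) ≤ S.comap (Tw.inA φ x y) := by
    refine Algebra.adjoin_le ?_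
    rintro _ ⟨i, rfl⟩ l hl
    change l * Tw.inA φ x y (x i) ∈ _
    rw [show l * Tw.inA φ x y (x i) = l * Tw.diff φ x y i + l * Tw.inB φ x y (φ (x i)) by
      rw [← mul_add, Tw.diff, sub_add_cancel]]
    exact Submodule.add_mem _ (Ideal.mul_mem_left _ _ (Ideal.subset_span ⟨i, rfl⟩)) (hB _ _ hl)
  rw [hx] at hA
  exact Tw.map_mem (AlgHom.id K _) S (fun a => hA (Algebra.mem_top (x := a))) hB t l hl

/-- The elements congruent to their image in `B` form a subalgebra, closed under products because
the left ideal is two-sided; it contains `B` and the `x_i`. This is the nontrivial half of the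
description of the kernel. -/
theorem Tw.sub_retract_mem (hx : Algebra.adjoin K (Set.range x) = ⊤)
    (hy : Algebra.adjoin K (Set.range y) = ⊤) (t : Tw φ x y) :
    t - Tw.inB φ x y (Tw.retract φ x y t) ∈ Ideal.span (Set.range (Tw.diff φ x y)) := by
  let S : Subalgebra K (Tw φ x y) :=
    { carrier := {t | t - Tw.inB φ x y (Tw.retract φ x y t) ∈
        Ideal.span (Set.range (Tw.diff φ x y))}
      mul_mem' := fun {a b} ha hb => by
        change a * b - Tw.inB φ x y (Tw.retract φ x y (a * b)) ∈ Ideal.span (Set.range (Tw.diff φ x y))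
        rw [map_mul, map_mul, show ∀ p q r s : Tw φ x y, p * q - r * s =
          p * (q - s) + (p - r) * s by intros; noncomm_ring]
        exact Submodule.add_mem _ (Ideal.mul_mem_left _ _ hb)
          (Tw.span_diff_mul_mem φ hx hy _ _ ha)
      add_mem' := fun {a b} ha hb => by
        change a + b - Tw.inB φ x y (Tw.retract φ x y (a + b)) ∈ Ideal.span (Set.range (Tw.diff φ x y))
        rw [map_add, map_add, add_sub_add_comm]; exact Submodule.add_mem _ ha hb
      algebraMap_mem' := fun c => by
        change algebraMap K _ c - Tw.inB φ x y (Tw.retract φ x y (algebraMap K _ c)) ∈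
          Ideal.span (Set.range (Tw.diff φ x y))
        rw [AlgHom.commutes, AlgHom.commutes, sub_self]; exact Submodule.zero_mem _ }
  have hB : ∀ b, Tw.inB φ x y b ∈ S := fun b => by
    change Tw.inB φ x y b - Tw.inB φ x y (Tw.retract φ x y (Tw.inB φ x y b)) ∈
      Ideal.span (Set.range (Tw.diff φ x y))
    rw [Tw.retract_inB, sub_self]; exact Submodule.zero_mem _
  have hA : Algebra.adjoin K (Set.range x) ≤ S.comap (Tw.inA φ x y) := by
    refine Algebra.adjoin_le ?_
    rintro _ ⟨i, rfl⟩
    change Tw.inA φ x y (x i) - Tw.inB φ x y (Tw.retract φ x y (Tw.inA φ x y (x i))) ∈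
      Ideal.span (Set.range (Tw.diff φ x y))
    rw [Tw.retract_inA]
    exact Ideal.subset_span ⟨i, rfl⟩
  rw [hx] at hA
  exact Tw.map_mem (AlgHom.id K _) S (fun a => hA (Algebra.mem_top (x := a))) hB t

theorem Tw.diff_mem_twI (i : ι) : Tw.diff φ x y i ∈ twI φ x y :=
  Submodule.subset_span ⟨1, 1, i, by simp [Tw.diff]⟩

theorem Tw.twI_le_ker {t : Tw φ x y} (ht : t ∈ twI φ x y) : Tw.retract φ x y t = 0 := by
  induction ht using Submodule.span_induction with
  | mem t h => obtain ⟨a, a', i, rfl⟩ := h; simp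
  | zero => exact map_zero _
  | add a b _ _ ha hb => rw [map_add, ha, hb, add_zero]
  | smul c t _ h => rw [map_smul, h, smul_zero]

/-- `E I_φ + E J` is the preimage of `J` in `E = A ⊗^φ B`. -/
theorem Tw.span_twI_sup_span (hx : Algebra.adjoin K (Set.range x) = ⊤)
    (hy : Algebra.adjoin K (Set.range y) = ⊤) (J : Ideal B) :
    Ideal.span (twI φ x y : Set (Tw φ x y)) ⊔ Ideal.span (Tw.inB φ x y '' J) =
      Ideal.comap (Tw.retract φ x y) J := by
  refine le_antisymm (sup_le (Ideal.span_le.mpr fun t ht => ?_) (Ideal.span_le.mpr ?_))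
    fun t ht => ?_
  · change Tw.retract φ x y t ∈ J
    rw [Tw.twI_le_ker φ ht]; exact J.zero_mem
  · rintro _ ⟨b, hb, rfl⟩
    change Tw.retract φ x y _ ∈ J
    rwa [Tw.retract_inB]
  · rw [← sub_add_cancel t (Tw.inB φ x y (Tw.retract φ x y t))]
    refine Submodule.add_mem_sup (Ideal.span_mono (Set.range_subset_iff.mpr
      fun i => Tw.diff_mem_twI φ i) (Tw.sub_retract_mem φ hx hy t))
      (Ideal.subset_span ⟨_, ht, rfl⟩)

end TwistedIdeals

theorem GAlg.adjoin_gen {K σ : Type*} [Field K] [Fintype σ] [LinearOrder σ]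
    (d : σ → σ → MvPolynomial σ K) : Algebra.adjoin K (Set.range (GAlg.gen d)) = ⊤ :=
  eq_top_iff.mpr fun w _ =>
    GAlg.map_mem (AlgHom.id K _) _ (fun i => Algebra.subset_adjoin (s := Set.range (GAlg.gen d)) ⟨i, rfl⟩) w

/-! ### The algebras `E` and `E'`, their retractions, and the two identities. -/

section Ideals

variable {K : Type*} [Field K] {r n k : ℕ}
  (dC : Fin r → Fin r → MvPolynomial (Fin r) K)
  {dA : Fin n → Fin n → MvPolynomial (Fin n) K}
  {dB : Fin k → Fin k → MvPolynomial (Fin k) K}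
  (φ₁ : GAlg dA →ₐ[K] GAlg dB)

theorem adjoin_tgen (dA : Fin n → Fin n → MvPolynomial (Fin n) K) :
    Algebra.adjoin K (Set.range (tgen dC dA)) = ⊤ := by
  refine eq_top_iff.mpr fun w _ => ?_
  induction w using TensorProduct.induction_on with
  | zero => exact Subalgebra.zero_mem _
  | add a b ha hb => exact Subalgebra.add_mem _ (ha trivial) (hb trivial)
  | tmul c a =>
    rw [show c ⊗ₜ[K] a = (c ⊗ₜ[K] 1) * (1 ⊗ₜ[K] a) by simp]
    refine Subalgebra.mul_mem _ ?_ ?_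
    · exact GAlg.map_mem (Algebra.TensorProduct.includeLeft (S := K) (B := GAlg dA)) _
        (fun l => Algebra.subset_adjoin (s := Set.range (tgen dC dA)) ⟨Sum.inlₗ l, rfl⟩) c
    · exact GAlg.map_mem (Algebra.TensorProduct.includeRight (A := GAlg dC)) _
        (fun l => Algebra.subset_adjoin (s := Set.range (tgen dC dA)) ⟨Sum.inrₗ l, rfl⟩) a

theorem jA_inA' (a : GAlg dC ⊗[K] GAlg dA) : jA dC φ₁ (inA' dC φ₁ a) = inA dC φ₁ a := by
  induction a using TensorProduct.induction_on with
  | zero => simp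
  | add a b ha hb => rw [map_add, map_add, ha, hb, map_add]
  | tmul c a => simp [jA, inA', tw₁ToE_inA, ← map_mul]

theorem jB_inB' (b : GAlg dC ⊗[K] GAlg dB) : jB dC φ₁ (inB' dC φ₁ b) = inB dC φ₁ b := by
  induction b using TensorProduct.induction_on with
  | zero => simp
  | add a b ha hb => rw [map_add, map_add, ha, hb, map_add]
  | tmul c a => simp [jB, inB', tw₁ToE_inB, ← map_mul]

/-- The homomorphism `E → E'` which restricts to the canonical maps on `A` and on `B`. -/
noncomputable def bigToSmall : BigE dC φ₁ →ₐ[K] SmallE dC φ₁ :=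
  Tw.lift (inA' dC φ₁) (inB' dC φ₁) (fun s t => by
    obtain ⟨s, rfl⟩ := toLex.surjective s
    obtain ⟨t, rfl⟩ := toLex.surjective t
    -- In `E'` the two copies of `C` coincide, so the relations involving a generator of `C` hold
    -- trivially. What remains is the cross relation of `A₁ ⊗^{φ₁} B₁`.
    rcases s with l | i <;> rcases t with l' | j
    · simp [tgen, inA', inB', bigHom]
    · simp [tgen, inA', inB', bigHom]
    · simp [tgen, inA', inB', bigHom]
    · have h := congrArg (fun z => (1 : GAlg dC) ⊗ₜ[K] z)
        (Tw.cross φ₁ (GAlg.gen dA) (GAlg.gen dB) i j)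
      simpa [tgen, inA', inB', bigHom, TensorProduct.tmul_sub] using h)

@[simp] theorem bigToSmall_inA (a) : bigToSmall dC φ₁ (inA dC φ₁ a) = inA' dC φ₁ a :=
  Tw.lift_inA _ _ _ _

@[simp] theorem bigToSmall_inB (b) : bigToSmall dC φ₁ (inB dC φ₁ b) = inB' dC φ₁ b :=
  Tw.lift_inB _ _ _ _

theorem bigToSmall_tw₁ToE (w : Tw₁ φ₁) :
    bigToSmall dC φ₁ (tw₁ToE dC φ₁ w) = 1 ⊗ₜ[K] w := by
  have h := Tw.map_mem (AlgHom.id K (Tw₁ φ₁))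
    (AlgHom.equalizer ((bigToSmall dC φ₁).comp (tw₁ToE dC φ₁))
      (Algebra.TensorProduct.includeRight (A := GAlg dC)))
    (fun a => by simp [AlgHom.mem_equalizer, tw₁ToE_inA, inA'])
    (fun a => by simp [AlgHom.mem_equalizer, tw₁ToE_inB, inB']) w
  exact h

theorem bigToSmall_jA (e : SmallE dC φ₁) : bigToSmall dC φ₁ (jA dC φ₁ e) = e := by
  induction e using TensorProduct.induction_on with
  | zero => simp
  | add a b ha hb => rw [map_add, map_add, ha, hb]
  | tmul c a => simp [jA, bigToSmall_tw₁ToE, inA']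

theorem bigToSmall_jB (e : SmallE dC φ₁) : bigToSmall dC φ₁ (jB dC φ₁ e) = e := by
  induction e using TensorProduct.induction_on with
  | zero => simp
  | add a b ha hb => rw [map_add, map_add, ha, hb]
  | tmul c a => simp [jB, bigToSmall_tw₁ToE, inB']

/-- The homomorphism `E' → B` which is `1_C ⊗ φ` on `A` and the identity on `B`. -/
noncomputable def smallRetract : SmallE dC φ₁ →ₐ[K] GAlg dC ⊗[K] GAlg dB :=
  Algebra.TensorProduct.map (AlgHom.id K (GAlg dC)) (Tw.retract φ₁ _ _)

theorem smallRetract_inA' (a) : smallRetract dC φ₁ (inA' dC φ₁ a) = bigHom dC φ₁ a := by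
  induction a using TensorProduct.induction_on with
  | zero => simp
  | add a b ha hb => rw [map_add, map_add, ha, hb, map_add]
  | tmul c a => simp [smallRetract, inA', bigHom]

theorem smallRetract_inB' (b) : smallRetract dC φ₁ (inB' dC φ₁ b) = b := by
  induction b using TensorProduct.induction_on with
  | zero => simp
  | add a b ha hb => rw [map_add, map_add, ha, hb]
  | tmul c a => simp [smallRetract, inB']

theorem retract_tw₁ToE (w : Tw₁ φ₁) :
    Tw.retract (bigHom dC φ₁) (tgen dC dA) (tgen dC dB) (tw₁ToE dC φ₁ w) =
      1 ⊗ₜ[K] Tw.retract φ₁ _ _ w := by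
  have h := Tw.map_mem (AlgHom.id K (Tw₁ φ₁))
    (AlgHom.equalizer ((Tw.retract (bigHom dC φ₁) (tgen dC dA) (tgen dC dB)).comp (tw₁ToE dC φ₁))
      ((Algebra.TensorProduct.includeRight (A := GAlg dC)).comp
        (Tw.retract φ₁ (GAlg.gen dA) (GAlg.gen dB))))
    (fun a => by
      simp only [AlgHom.mem_equalizer, AlgHom.coe_id, id_eq, AlgHom.comp_apply, tw₁ToE_inA, inA,
        Tw.retract_inA]
      simp [bigHom])
    (fun a => by
      simp only [AlgHom.mem_equalizer, AlgHom.coe_id, id_eq, AlgHom.comp_apply, tw₁ToE_inB, inB,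
        Tw.retract_inB]
      simp) w
  exact h

/-- As `φ` is the identity on `C`, both copies of `C` in `E` have the same image in `B`. This is why
`j_A` and `j_B` lead to the same contraction. -/
theorem retract_jA (e : SmallE dC φ₁) :
    Tw.retract (bigHom dC φ₁) (tgen dC dA) (tgen dC dB) (jA dC φ₁ e) = smallRetract dC φ₁ e := by
  induction e using TensorProduct.induction_on with
  | zero => simp
  | add a b ha hb => rw [map_add, map_add, ha, hb, map_add]
  | tmul c a =>
    rw [jA, Algebra.TensorProduct.lift_tmul, map_mul, retract_tw₁ToE, AlgHom.comp_apply, inA,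
      Tw.retract_inA]
    simp [smallRetract, bigHom]

theorem retract_jB (e : SmallE dC φ₁) :
    Tw.retract (bigHom dC φ₁) (tgen dC dA) (tgen dC dB) (jB dC φ₁ e) = smallRetract dC φ₁ e := by
  induction e using TensorProduct.induction_on with
  | zero => simp
  | add a b ha hb => rw [map_add, map_add, ha, hb, map_add]
  | tmul c a => simp [jB, retract_tw₁ToE, smallRetract, inB]

/-- The elements `x_i - φ₁(x_i)` of `E'`. -/
noncomputable def smallDiff (i : Fin n) : SmallE dC φ₁ :=
  inA' dC φ₁ (1 ⊗ₜ[K] GAlg.gen dA i) - inB' dC φ₁ (1 ⊗ₜ[K] φ₁ (GAlg.gen dA i))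

theorem smallDiff_eq (i : Fin n) :
    smallDiff dC φ₁ i = 1 ⊗ₜ[K] Tw.diff φ₁ (GAlg.gen dA) (GAlg.gen dB) i := by
  simp [smallDiff, inA', inB', Tw.diff, TensorProduct.tmul_sub]

theorem sub_smallRetract_mem (e : SmallE dC φ₁) :
    e - inB' dC φ₁ (smallRetract dC φ₁ e) ∈ Ideal.span (Set.range (smallDiff dC φ₁)) := by
  induction e using TensorProduct.induction_on with
  | zero => simp
  | add a b ha hb =>
    rw [map_add, map_add, add_sub_add_comm]
    exact Submodule.add_mem _ ha hb
  | tmul c t =>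
    have h : (1 : GAlg dC) ⊗ₜ[K] (t - Tw.inB φ₁ _ _ (Tw.retract φ₁ _ _ t)) ∈
        Ideal.span (Set.range (smallDiff dC φ₁)) := by
      have h := Tw.sub_retract_mem φ₁ (GAlg.adjoin_gen dA) (GAlg.adjoin_gen dB) t
      refine (Ideal.span_le (I := Ideal.comap
        (Algebra.TensorProduct.includeRight (R := K) (A := GAlg dC) (B := Tw₁ φ₁))
        (Ideal.span (Set.range (smallDiff dC φ₁))))).mpr ?_ h
      rintro _ ⟨i, rfl⟩
      exact Ideal.subset_span ⟨i, smallDiff_eq dC φ₁ i⟩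
    -- Left multiplication by `c ⊗ 1` carries the result for `A₁ ⊗^{φ₁} B₁` to all pure tensors.
    have h' := Ideal.mul_mem_left _ (c ⊗ₜ[K] 1) h
    rw [Algebra.TensorProduct.tmul_mul_tmul, mul_one, one_mul, TensorProduct.tmul_sub] at h'
    simpa [smallRetract, inB'] using h'

theorem smallRetract_smallDiff (i : Fin n) : smallRetract dC φ₁ (smallDiff dC φ₁ i) = 0 := by
  simp [smallDiff_eq, smallRetract, Tw.retract_diff]

theorem smallRetract_smallI {e : SmallE dC φ₁} (he : e ∈ smallI dC φ₁) :
    smallRetract dC φ₁ e = 0 := by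
  obtain ⟨w, hw, rfl⟩ := he
  simp [smallRetract, Tw.twI_le_ker φ₁ hw]

theorem smallDiff_mem_smallI (i : Fin n) : smallDiff dC φ₁ i ∈ smallI dC φ₁ :=
  ⟨_, Tw.diff_mem_twI φ₁ i, (smallDiff_eq dC φ₁ i).symm⟩

/-- Stated for an arbitrary generating set `F`, it serves twice: with `F = J` for `smallIdeal_eq`,
and in general for the explicit generators of the ideal. -/
theorem span_smallDiff_union (F : Set (GAlg dC ⊗[K] GAlg dB)) :
    Ideal.span (Set.range (smallDiff dC φ₁) ∪ inB' dC φ₁ '' F) =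
      Ideal.comap (smallRetract dC φ₁) (Ideal.span F) := by
  refine le_antisymm (Ideal.span_le.mpr ?_) fun e he => ?_
  · rintro _ (⟨i, rfl⟩ | ⟨b, hb, rfl⟩)
    · change smallRetract dC φ₁ _ ∈ Ideal.span F
      rw [smallRetract_smallDiff]; exact Submodule.zero_mem _
    · change smallRetract dC φ₁ _ ∈ Ideal.span F
      rw [smallRetract_inB']; exact Ideal.subset_span hb
  · rw [← sub_add_cancel e (inB' dC φ₁ (smallRetract dC φ₁ e))]
    refine Submodule.add_mem _
      (Ideal.span_mono Set.subset_union_left (sub_smallRetract_mem dC φ₁ e)) ?_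
    refine (Ideal.span_le (I := Ideal.comap (inB' dC φ₁)
      (Ideal.span (Set.range (smallDiff dC φ₁) ∪ inB' dC φ₁ '' F)))).mpr ?_ he
    exact fun b hb => Ideal.subset_span (Or.inr ⟨b, hb, rfl⟩)

theorem smallIdeal_eq (J : Ideal (GAlg dC ⊗[K] GAlg dB)) :
    smallIdeal dC φ₁ J = Ideal.comap (smallRetract dC φ₁) J := by
  refine le_antisymm (sup_le (Ideal.span_le.mpr fun e he => ?_) (Ideal.span_le.mpr ?_)) ?_
  · change smallRetract dC φ₁ e ∈ J
    rw [smallRetract_smallI dC φ₁ he]; exact J.zero_mem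
  · rintro _ ⟨b, hb, rfl⟩
    change smallRetract dC φ₁ _ ∈ J
    rwa [smallRetract_inB']
  · have h := span_smallDiff_union dC φ₁ (J : Set _)
    rw [Ideal.span_eq] at h
    rw [← h, Ideal.span_union]
    refine sup_le_sup (Ideal.span_mono ?_) le_rfl
    rintro _ ⟨i, rfl⟩
    exact smallDiff_mem_smallI dC φ₁ i

/-- Contraction undoes extension along an embedding with a left inverse `ρ`: if `j e` lies in the
extended ideal, then applying `ρ` puts `e` in the original one. -/
theorem comap_span_image_sup {R S : Type*} [Ring R] [Ring S] (j : R →+* S) (ρ : S →+* R)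
    (h : ∀ e, ρ (j e) = e) (X Y : Set R) (Z : Set S) (hZ : ρ '' Z ⊆ Y) (hZ' : j '' Y ⊆ Z) :
    Ideal.comap j (Ideal.span (j '' X) ⊔ Ideal.span Z) = Ideal.span X ⊔ Ideal.span Y := by
  refine le_antisymm (fun e he => ?_) ?_
  · have h1 : Ideal.span (j '' X) ⊔ Ideal.span Z ≤ Ideal.comap ρ (Ideal.span X ⊔ Ideal.span Y) := by
      refine sup_le (Ideal.span_le.mpr ?_) (Ideal.span_le.mpr fun z hz => ?_)
      · rintro _ ⟨a, ha, rfl⟩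
        change ρ (j a) ∈ Ideal.span X ⊔ Ideal.span Y
        rw [h]; exact Submodule.mem_sup_left (Ideal.subset_span ha)
      · exact Submodule.mem_sup_right (Ideal.subset_span (hZ ⟨z, hz, rfl⟩))
    have := h1 he
    rwa [Ideal.mem_comap, h] at this
  · refine sup_le (Ideal.span_le.mpr fun a ha => ?_) (Ideal.span_le.mpr fun a ha => ?_)
    · exact Submodule.mem_sup_left (Ideal.subset_span ⟨a, ha, rfl⟩)
    · exact Submodule.mem_sup_right (Ideal.subset_span (hZ' ⟨a, ha, rfl⟩))

theorem comap_jB_span_smallI (J : Ideal (GAlg dC ⊗[K] GAlg dB)) :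
    Ideal.comap (jB dC φ₁)
        (Ideal.span (jB dC φ₁ '' smallI dC φ₁) ⊔ Ideal.span (inB dC φ₁ '' J)) =
      smallIdeal dC φ₁ J := by
  refine comap_span_image_sup (jB dC φ₁ : SmallE dC φ₁ →+* BigE dC φ₁)
    (bigToSmall dC φ₁ : BigE dC φ₁ →+* SmallE dC φ₁) (bigToSmall_jB dC φ₁) _ _ _ ?_ ?_
  · rintro _ ⟨_, ⟨b, hb, rfl⟩, rfl⟩
    exact ⟨b, hb, (bigToSmall_inB dC φ₁ b).symm⟩
  · rintro _ ⟨_, ⟨b, hb, rfl⟩, rfl⟩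
    exact ⟨b, hb, (jB_inB' dC φ₁ b).symm⟩

theorem comap_jA_span_smallI (J : Ideal (GAlg dC ⊗[K] GAlg dB)) :
    Ideal.comap (jA dC φ₁)
        (Ideal.span (jA dC φ₁ '' smallI dC φ₁) ⊔
          Ideal.span (jA dC φ₁ '' (inB' dC φ₁ '' J))) =
      smallIdeal dC φ₁ J := by
  refine comap_span_image_sup (jA dC φ₁ : SmallE dC φ₁ →+* BigE dC φ₁)
    (bigToSmall dC φ₁ : BigE dC φ₁ →+* SmallE dC φ₁) (bigToSmall_jA dC φ₁) _ _ _ ?_ ?_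
  · rintro _ ⟨_, ⟨b, hb, rfl⟩, rfl⟩
    change bigToSmall dC φ₁ (jA dC φ₁ b) ∈ _
    rwa [bigToSmall_jA]
  · exact subset_rfl

theorem span_bigI_sup (J : Ideal (GAlg dC ⊗[K] GAlg dB)) :
    Ideal.span (bigI dC φ₁) ⊔ Ideal.span (inB dC φ₁ '' J) =
      Ideal.comap (Tw.retract (bigHom dC φ₁) (tgen dC dA) (tgen dC dB)) J :=
  Tw.span_twI_sup_span _ (adjoin_tgen dC dA) (adjoin_tgen dC dB) J

theorem comap_jB_span_bigI (J : Ideal (GAlg dC ⊗[K] GAlg dB)) :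
    Ideal.comap (jB dC φ₁) (Ideal.span (bigI dC φ₁) ⊔ Ideal.span (inB dC φ₁ '' J)) =
      smallIdeal dC φ₁ J := by
  rw [span_bigI_sup, smallIdeal_eq]
  ext e
  simp only [Ideal.mem_comap, retract_jB]

theorem comap_jA_span_bigI (J : Ideal (GAlg dC ⊗[K] GAlg dB)) :
    Ideal.comap (jA dC φ₁) (Ideal.span (bigI dC φ₁) ⊔ Ideal.span (inB dC φ₁ '' J)) =
      smallIdeal dC φ₁ J := by
  rw [span_bigI_sup, smallIdeal_eq]
  ext e
  simp only [Ideal.mem_comap, retract_jA]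

theorem comap_bigHom_eq (J : Ideal (GAlg dC ⊗[K] GAlg dB)) :
    Ideal.comap (bigHom dC φ₁) J = Ideal.comap (inA' dC φ₁) (smallIdeal dC φ₁ J) := by
  rw [smallIdeal_eq]
  ext e
  simp only [Ideal.mem_comap, smallRetract_inA']

end Ideals

end GLie

namespace GLie

/-! ### Words, exponent vectors and the well-founded order used for rewriting. -/

section Words

variable {σ : Type} [Fintype σ] [LinearOrder σ]

/-- The exponent vector of a word. -/
noncomputable def wexp (w : List σ) : σ →₀ ℕ := Multiset.toFinsupp (w : Multiset σ)

omit [Fintype σ] in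
theorem wexp_append (u v : List σ) : wexp (u ++ v) = wexp u + wexp v := by
  rw [wexp, ← Multiset.coe_add, map_add]; rfl

omit [Fintype σ] in
theorem wexp_cons (a : σ) (v : List σ) : wexp (a :: v) = Finsupp.single a 1 + wexp v := by
  rw [← List.singleton_append, wexp_append, wexp, Multiset.coe_singleton,
    Multiset.toFinsupp_singleton]

omit [Fintype σ] in
@[simp] theorem wexp_nil : wexp ([] : List σ) = 0 := by simp [wexp]

omit [Fintype σ] in
theorem perm_of_wexp_eq {u v : List σ} (h : wexp u = wexp v) : u.Perm v :=
  Multiset.coe_eq_coe.mp (Multiset.toFinsupp.injective h)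

/-- The standard word with a given exponent vector. -/
def stdWord (α : σ →₀ ℕ) : List σ :=
  ((Finset.univ : Finset σ).sort (· ≤ ·)).flatMap fun i => List.replicate (α i) i

theorem stdMon_eq_prod {R : Type*} [Monoid R] (v : σ → R) (α : σ →₀ ℕ) :
    stdMon v α = ((stdWord α).map v).prod := by
  rw [stdMon, stdWord]
  induction (Finset.univ : Finset σ).sort (· ≤ ·) with
  | nil => simp
  | cons a l ih => simp [ih]

theorem wexp_stdWord (α : σ →₀ ℕ) : wexp (stdWord α) = α := by
  ext i
  rw [wexp, Multiset.toFinsupp_apply, Multiset.coe_count, stdWord, List.count_flatMap,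
    ← List.sum_toFinset _ (Finset.sort_nodup _ _), Finset.sort_toFinset,
    Finset.sum_eq_single i]
  · simp
  · intro j _ hj
    simp [List.count_replicate, hj]
  · simp

theorem pairwise_stdWord (α : σ →₀ ℕ) : (stdWord α).Pairwise (· ≤ ·) := by
  refine List.pairwise_flatMap.mpr ⟨fun a _ => List.pairwise_replicate.mpr (Or.inr le_rfl),
    (Finset.pairwise_sort _ _).imp fun h a ha b hb => ?_⟩
  rwa [List.eq_of_mem_replicate ha, List.eq_of_mem_replicate hb]

omit [Fintype σ] in
theorem pairwise_of_no_descent (w : List σ)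
    (h : ∀ u j i v, i < j → w ≠ u ++ j :: i :: v) : w.Pairwise (· ≤ ·) := by
  rw [← List.isChain_iff_pairwise]
  induction w with
  | nil => exact List.IsChain.nil
  | cons a w ih =>
    have hw := ih fun u j i v hij hw => h (a :: u) j i v hij (by rw [hw]; rfl)
    cases w with
    | nil => exact List.IsChain.singleton a
    | cons b w =>
      exact List.IsChain.cons_cons (not_lt.mp fun hba => h [] a b w hba rfl) hw

theorem eq_stdWord_of_pairwise {w : List σ} (h : w.Pairwise (· ≤ ·)) : w = stdWord (wexp w) :=
  List.Perm.eq_of_pairwise (fun _ _ _ _ h h' => le_antisymm h h') h (pairwise_stdWord _)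
    (perm_of_wexp_eq (wexp_stdWord _).symm)

/-- The number of inversions of a word. -/
def inversions : List σ → ℕ
  | [] => 0
  | a :: l => l.countP (· < a) + inversions l

omit [Fintype σ] in
theorem inversions_swap {i j : σ} (h : i < j) (u v : List σ) :
    inversions (u ++ i :: j :: v) < inversions (u ++ j :: i :: v) := by
  induction u with
  | nil =>
    simp only [List.nil_append, inversions, List.countP_cons, decide_eq_true_eq, h, h.not_gt,
      if_true, if_false]
    omega
  | cons a u ih =>
    have hp : (u ++ i :: j :: v).Perm (u ++ j :: i :: v) :=
      List.Perm.append_left u (List.Perm.swap j i v)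
    simp only [List.cons_append, inversions, hp.countP_eq]
    omega

/-- Words are compared by their exponent vectors, then by the number of inversions. -/
def WordLT (m : MonomialOrder.{0, 0} σ) (w w' : List σ) : Prop :=
  Prod.Lex (· < ·) (· < ·) (m.toSyn (wexp w), inversions w) (m.toSyn (wexp w'), inversions w')

variable {m : MonomialOrder.{0, 0} σ}

omit [Fintype σ] in
theorem wordLT_iff {w w' : List σ} : WordLT m w w' ↔
    wexp w ≺[m] wexp w' ∨ wexp w = wexp w' ∧ inversions w < inversions w' := by
  rw [WordLT, Prod.lex_def]
  simp

omit [Fintype σ] in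
theorem WordLT.of_wexp {w w' : List σ} (h : wexp w ≺[m] wexp w') : WordLT m w w' :=
  wordLT_iff.mpr (Or.inl h)

omit [Fintype σ] in
theorem WordLT.trans {a b c : List σ} (h : WordLT m a b) (h' : WordLT m b c) : WordLT m a c := by
  rw [wordLT_iff] at *
  rcases h with h | ⟨h, h1⟩ <;> rcases h' with h' | ⟨h', h2⟩
  · exact Or.inl (h.trans h')
  · exact Or.inl (h' ▸ h)
  · exact Or.inl (h ▸ h')
  · exact Or.inr ⟨h.trans h', h1.trans h2⟩

omit [Fintype σ] in
theorem WordLT.swap {i j : σ} (h : i < j) (u v : List σ) :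
    WordLT m (u ++ i :: j :: v) (u ++ j :: i :: v) := by
  refine wordLT_iff.mpr (Or.inr ⟨?_, inversions_swap h u v⟩)
  simp only [wexp_append, wexp_cons]
  abel

variable (m) in
omit [Fintype σ] in
theorem wordLT_wf : WellFounded (WordLT m) :=
  InvImage.wf (fun w : List σ => (m.toSyn (wexp w), inversions w))
    (WellFounded.prod_lex wellFounded_lt wellFounded_lt)

omit [Fintype σ] in
theorem WordLT.of_middle {a b : List σ} (h : wexp a ≺[m] wexp b) (u v : List σ) :
    WordLT m (u ++ a ++ v) (u ++ b ++ v) := by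
  refine WordLT.of_wexp ?_
  simp only [wexp_append, map_add]
  gcongr

omit [Fintype σ] in
theorem wexp_pair (i j : σ) : wexp [j, i] = Finsupp.single i 1 + Finsupp.single j 1 := by
  simp only [wexp_cons, wexp_nil, add_zero]
  abel

end Words

/-! ### Words as a basis of the free algebra, and the terms produced by a replacement. -/

section FreeAlgebra

variable {K : Type*} [Field K] {σ : Type} [Fintype σ] [LinearOrder σ]

omit [Fintype σ] [LinearOrder σ] in
theorem word_append (u v : List σ) : (word (u ++ v) : FreeAlgebra K σ) = word u * word v := by
  simp [word]

omit [Fintype σ] [LinearOrder σ] in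
theorem word_cons (a : σ) (v : List σ) :
    (word (a :: v) : FreeAlgebra K σ) = FreeAlgebra.ι K a * word v := by
  simp [word]

omit [Fintype σ] [LinearOrder σ] in
@[simp] theorem word_nil : (word [] : FreeAlgebra K σ) = 1 := by simp [word]

theorem stdMon_ι (α : σ →₀ ℕ) : stdMon (FreeAlgebra.ι K) α = word (stdWord α) :=
  stdMon_eq_prod _ _

omit [Fintype σ] [LinearOrder σ] in
theorem equiv_word (w : List σ) : FreeAlgebra.equivMonoidAlgebraFreeMonoid (word w : FreeAlgebra K σ) =
    MonoidAlgebra.single (FreeMonoid.ofList w) 1 := by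
  induction w with
  | nil => rw [word_nil, map_one]; rfl
  | cons a w ih =>
    rw [word_cons, map_mul, ih, FreeMonoid.ofList_cons]
    simp [FreeAlgebra.equivMonoidAlgebraFreeMonoid, MonoidAlgebra.of_apply,
      MonoidAlgebra.single_mul_single]

omit [Fintype σ] [LinearOrder σ] in
theorem basisFreeMonoid_eq_word (w : FreeMonoid σ) :
    FreeAlgebra.basisFreeMonoid K σ w = word w.toList := by
  apply FreeAlgebra.equivMonoidAlgebraFreeMonoid.injective
  rw [equiv_word]
  simp [FreeAlgebra.basisFreeMonoid]

omit [Fintype σ] in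
theorem wordCoeff_word (w w' : List σ) :
    wordCoeff w (word w' : FreeAlgebra K σ) = if w' = w then 1 else 0 := by
  classical
  rw [wordCoeff, equiv_word, MonoidAlgebra.coeff_single, Finsupp.single_apply]
  simp

omit [Fintype σ] [LinearOrder σ] in
theorem span_word : Submodule.span K (Set.range (word : List σ → FreeAlgebra K σ)) = ⊤ := by
  rw [← (FreeAlgebra.basisFreeMonoid K σ).span_eq]
  congr 1
  ext x
  constructor
  · rintro ⟨w, rfl⟩
    exact ⟨FreeMonoid.ofList w, basisFreeMonoid_eq_word _⟩
  · rintro ⟨w, rfl⟩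
    exact ⟨w.toList, (basisFreeMonoid_eq_word _).symm⟩

/-- The span of the words whose exponent vector is smaller than `e`. -/
def lowSpan (K : Type*) [Field K] (m : MonomialOrder.{0, 0} σ) (e : σ →₀ ℕ) :
    Submodule K (FreeAlgebra K σ) :=
  Submodule.span K (word '' {w | wexp w ≺[m] e})

variable {m : MonomialOrder.{0, 0} σ}

omit [Fintype σ] in
theorem word_mem_lowSpan {w : List σ} {e : σ →₀ ℕ} (h : wexp w ≺[m] e) :
    (word w : FreeAlgebra K σ) ∈ lowSpan K m e :=
  Submodule.subset_span ⟨w, h, rfl⟩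

omit [Fintype σ] in
theorem wexp_lt_of_wordCoeff_ne_zero {p : FreeAlgebra K σ} {e : σ →₀ ℕ} (hp : p ∈ lowSpan K m e)
    {w : List σ} (hw : wordCoeff w p ≠ 0) : wexp w ≺[m] e := by
  contrapose! hw
  induction hp using Submodule.span_induction with
  | mem p h =>
    obtain ⟨w', h', rfl⟩ := h
    rw [wordCoeff_word, if_neg]
    rintro rfl
    exact absurd h' hw.not_gt
  | zero => simp [wordCoeff]
  | add a b _ _ ha hb =>
    simp only [wordCoeff, map_add, MonoidAlgebra.coeff_add, Finsupp.add_apply] at *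
    rw [ha, hb, add_zero]
  | smul c a _ h =>
    simp only [wordCoeff, map_smul, MonoidAlgebra.coeff_smul, Finsupp.smul_apply] at *
    rw [h, smul_zero]

omit [Fintype σ] in
theorem word_mul_mul_mem_lowSpan {p : FreeAlgebra K σ} {e : σ →₀ ℕ} (hp : p ∈ lowSpan K m e)
    (u v : List σ) : word u * p * word v ∈ lowSpan K m (wexp u + e + wexp v) := by
  induction hp using Submodule.span_induction with
  | mem p h =>
    obtain ⟨w, h, rfl⟩ := h
    rw [← word_append, ← word_append]
    refine word_mem_lowSpan ?_
    simp only [wexp_append, map_add]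
    have h : wexp w ≺[m] e := h
    gcongr
  | zero => simp
  | add a b _ _ ha hb => rw [mul_add, add_mul]; exact Submodule.add_mem _ ha hb
  | smul c a _ h => rw [mul_smul_comm, smul_mul_assoc]; exact Submodule.smul_mem _ _ h

theorem freeD_mem_lowSpan {d : σ → σ → MvPolynomial σ K} {i j : σ}
    (hd : m.degree (d i j) ≺[m] Finsupp.single i 1 + Finsupp.single j 1) :
    freeD d i j ∈ lowSpan K m (Finsupp.single i 1 + Finsupp.single j 1) := by
  refine Submodule.sum_mem _ fun α hα => Submodule.smul_mem _ _ ?_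
  rw [stdMon_ι]
  refine word_mem_lowSpan ?_
  rw [wexp_stdWord]
  exact (m.le_degree hα).trans_lt hd

/-- The relation `x_j x_i - x_i x_j - d_ij`. -/
noncomputable def relator (d : σ → σ → MvPolynomial σ K) (i j : σ) : FreeAlgebra K σ :=
  FreeAlgebra.ι K j * FreeAlgebra.ι K i - FreeAlgebra.ι K i * FreeAlgebra.ι K j - freeD d i j

/-- The expression `x_i x_j + d_ij` by which `x_j x_i` is replaced. -/
noncomputable def reduct (d : σ → σ → MvPolynomial σ K) (i j : σ) : FreeAlgebra K σ :=
  FreeAlgebra.ι K i * FreeAlgebra.ι K j + freeD d i j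

theorem reduct_add_relator (d : σ → σ → MvPolynomial σ K) (i j : σ) :
    reduct d i j + relator d i j = word [j, i] := by
  simp only [reduct, relator, word_cons, word_nil, mul_one]
  abel

/-- The terms decrease for two reasons: `x_i x_j` has the same exponent vector but fewer inversions,
and the monomials of `d_ij` have smaller exponent vectors. The comparison is made inside all
contexts `u`, `v` because it is applied to subwords. -/
theorem reduct_mem_span {d : σ → σ → MvPolynomial σ K} {i j : σ}
    (hd : m.degree (d i j) ≺[m] Finsupp.single i 1 + Finsupp.single j 1) (hij : i < j) :
    reduct d i j ∈ Submodule.span K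
      (word '' {t | ∀ u v : List σ, WordLT m (u ++ t ++ v) (u ++ [j, i] ++ v)}) := by
  refine Submodule.add_mem _ (Submodule.subset_span ⟨[i, j], fun u v => ?_, ?_⟩)
    (Submodule.span_mono ?_ (freeD_mem_lowSpan hd))
  · simpa using WordLT.swap hij u v
  · simp [word_cons]
  · refine Set.image_mono fun t ht u v => WordLT.of_middle ?_ u v
    rwa [wexp_pair]

end FreeAlgebra

/-! ### The normal form map. -/

section NormalForm

variable {K : Type*} [Field K] {σ : Type} [Fintype σ] [LinearOrder σ]
  (m : MonomialOrder.{0, 0} σ) (d : σ → σ → MvPolynomial σ K)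

/-- The words with a descent at a given place. -/
def descentWord (s : List σ × σ × σ × List σ) : List σ := s.1 ++ s.2.1 :: s.2.2.1 :: s.2.2.2

open Classical in
/-- The normal form of a word, by recursion: a descent, if there is one, is replaced by means of
the corresponding relation. -/
noncomputable def normalWord : List σ → MvPolynomial σ K :=
  (wordLT_wf m).fix fun w rec =>
    if h : ∃ s : List σ × σ × σ × List σ, s.2.2.1 < s.2.1 ∧ w = descentWord s then
      -- The value `0` only makes the recursion total; under the bound on `lm(d_ij)` all the calls
      -- made are to smaller words.
      let g : List σ → MvPolynomial σ K := fun w' => if h' : WordLT m w' w then rec w' h' else 0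
      g (h.choose.1 ++ h.choose.2.2.1 :: h.choose.2.1 :: h.choose.2.2.2) +
        ∑ α ∈ (d h.choose.2.2.1 h.choose.2.1).support,
          MvPolynomial.coeff α (d h.choose.2.2.1 h.choose.2.1) •
            g (h.choose.1 ++ stdWord α ++ h.choose.2.2.2)
    else MvPolynomial.monomial (wexp w) 1

/-- The normal form, as a linear map on the free algebra. -/
noncomputable def normalForm : FreeAlgebra K σ →ₗ[K] MvPolynomial σ K :=
  (FreeAlgebra.basisFreeMonoid K σ).constr K fun w => normalWord m d w.toList

theorem normalForm_word (w : List σ) : normalForm m d (word w) = normalWord m d w := by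
  have h := (FreeAlgebra.basisFreeMonoid K σ).constr_basis K
    (fun w => normalWord m d w.toList) (FreeMonoid.ofList w)
  rwa [basisFreeMonoid_eq_word] at h

theorem normalForm_word_of_pairwise {w : List σ} (hw : w.Pairwise (· ≤ ·)) :
    normalForm m d (word w) = MvPolynomial.monomial (wexp w) 1 := by
  rw [normalForm_word, normalWord, WellFounded.fix_eq, dif_neg]
  rintro ⟨⟨u, j, i, v⟩, hij, rfl⟩
  have h := (List.pairwise_append.mp hw).2.1
  have := List.rel_of_pairwise_cons h (List.mem_cons_self)
  exact absurd hij this.not_gt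

variable {m d} (hd : ∀ i j : σ, i < j → m.degree (d i j) ≺[m] Finsupp.single i 1 + Finsupp.single j 1)
include hd

theorem exists_normalForm_eq {w : List σ}
    (hw : ∃ s : List σ × σ × σ × List σ, s.2.2.1 < s.2.1 ∧ w = descentWord s) :
    ∃ u j i v, i < j ∧ w = u ++ j :: i :: v ∧
      normalForm m d (word w) = normalForm m d (word u * reduct d i j * word v) := by
  refine ⟨hw.choose.1, hw.choose.2.1, hw.choose.2.2.1, hw.choose.2.2.2, hw.choose_spec.1,
    hw.choose_spec.2, ?_⟩
  obtain ⟨hij, h⟩ := hw.choose_spec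
  -- The last rewrite folds the fixed point back, so that the recursive calls read as `normalWord`.
  rw [normalForm_word, normalWord, WellFounded.fix_eq, dif_pos hw, ← normalWord.eq_def]
  dsimp only
  generalize hw.choose = s at *
  obtain ⟨u, j, i, v⟩ := s
  simp only [descentWord] at *
  subst h
  rw [dif_pos (WordLT.swap hij u v), reduct, mul_add, add_mul, map_add]
  congr 1
  · rw [← normalForm_word]
    simp only [word_append, word_cons, mul_assoc]
  · rw [freeD, stdEval, Finset.mul_sum, Finset.sum_mul, map_sum]
    refine Finset.sum_congr rfl fun α hα => ?_
    rw [mul_smul_comm, smul_mul_assoc, map_smul, stdMon_ι, ← word_append, ← word_append,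
      normalForm_word, dif_pos]
    have := WordLT.of_middle (m := m) (a := stdWord α) (b := [j, i]) (by
      rw [wexp_pair, wexp_stdWord]; exact (m.le_degree hα).trans_lt (hd i j hij)) u v
    simpa using this

end NormalForm

end GLie

namespace GLie

/-! ### The diamond lemma and the independence of standard monomials. -/

section Confluence

variable {K : Type*} [Field K] {σ : Type} [Fintype σ] [LinearOrder σ]
  {m : MonomialOrder.{0, 0} σ} {d : σ → σ → MvPolynomial σ K}

/-- The functional `N` kills the relations in which the leading word is smaller than `w`. -/
def KillsBelow {V : Type*} [AddCommGroup V] [Module K V] (m : MonomialOrder.{0, 0} σ)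
    (d : σ → σ → MvPolynomial σ K) (N : FreeAlgebra K σ →ₗ[K] V) (w : List σ) : Prop :=
  ∀ u j i v, i < j → WordLT m (u ++ j :: i :: v) w → N (word u * relator d i j * word v) = 0

variable {V : Type*} [AddCommGroup V] [Module K V] {N : FreeAlgebra K σ →ₗ[K] V} {w : List σ}
  (hd : ∀ i j : σ, i < j → m.degree (d i j) ≺[m] Finsupp.single i 1 + Finsupp.single j 1)
include hd

theorem KillsBelow.step (hN : KillsBelow m d N w) {u v : List σ} {e : σ →₀ ℕ}
    (he : wexp u + e + wexp v = wexp w) {p q : FreeAlgebra K σ} (hp : p ∈ lowSpan K m e)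
    (h : Step d p q) :
    q ∈ lowSpan K m e ∧ N (word u * p * word v) = N (word u * q * word v) := by
  obtain ⟨u', v', i, j, hij, rfl⟩ := h
  -- A step at a word absent from `p` changes nothing, and such a word need not be small. Otherwise
  -- the word lies below `e`, so its relator, put between `u` and `v`, is killed by `N`.
  by_cases h0 : wordCoeff (u' ++ [j, i] ++ v') p = 0
  · rw [h0, zero_smul, sub_zero]
    exact ⟨hp, rfl⟩
  have hlt := wexp_lt_of_wordCoeff_ne_zero hp h0
  generalize wordCoeff (u' ++ [j, i] ++ v') p = c
  change p - c • (word u' * relator d i j * word v') ∈ _ ∧ _ =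
    N (word u * (p - c • (word u' * relator d i j * word v')) * word v)
  constructor
  · refine Submodule.sub_mem _ hp (Submodule.smul_mem _ _ ?_)
    rw [wexp_append, wexp_append, wexp_pair] at hlt
    rw [relator, mul_sub, sub_mul, mul_sub, sub_mul]
    refine Submodule.sub_mem _ (Submodule.sub_mem _ ?_ ?_) ?_
    · rw [show word u' * (FreeAlgebra.ι K j * FreeAlgebra.ι K i) * word v' =
        word (u' ++ [j, i] ++ v') by simp [word_append, word_cons, mul_assoc]]
      refine word_mem_lowSpan ?_
      rwa [wexp_append, wexp_append, wexp_pair]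
    · rw [show word u' * (FreeAlgebra.ι K i * FreeAlgebra.ι K j) * word v' =
        word (u' ++ [i, j] ++ v') by simp [word_append, word_cons, mul_assoc]]
      refine word_mem_lowSpan ?_
      rwa [wexp_append, wexp_append, wexp_pair, add_comm (Finsupp.single j 1)]
    · refine Submodule.span_mono (Set.image_mono fun t ht => ?_)
        (word_mul_mul_mem_lowSpan (freeD_mem_lowSpan (hd i j hij)) u' v')
      exact lt_trans ht hlt
  · have h := hN (u ++ u') j i (v' ++ v) hij (WordLT.of_wexp (by
      rw [← he]
      rw [wexp_append, wexp_append, wexp_pair] at hlt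
      have : wexp (u ++ u' ++ j :: i :: (v' ++ v)) = wexp u + (wexp u' +
          (Finsupp.single i 1 + Finsupp.single j 1) + wexp v') + wexp v := by
        simp only [wexp_append, wexp_cons]; abel
      rw [this]
      simp only [map_add] at hlt ⊢
      gcongr))
    rw [mul_sub, sub_mul, mul_smul_comm, smul_mul_assoc, map_sub, map_smul]
    rw [word_append, word_append] at h
    rw [show word u * (word u' * relator d i j * word v') * word v =
      word u * word u' * relator d i j * (word v' * word v) by simp only [mul_assoc], h,
      smul_zero, sub_zero]

theorem KillsBelow.of_reduces (hN : KillsBelow m d N w) {u v : List σ} {e : σ →₀ ℕ}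
    (he : wexp u + e + wexp v = wexp w) {p : FreeAlgebra K σ} (hp : p ∈ lowSpan K m e)
    (h : Relation.ReflTransGen (Step d) p 0) : N (word u * p * word v) = 0 := by
  suffices H : ∀ q, Relation.ReflTransGen (Step d) p q →
      q ∈ lowSpan K m e ∧ N (word u * p * word v) = N (word u * q * word v) by
    simpa using (H 0 h).2
  intro q hq
  induction hq with
  | refl => exact ⟨hp, rfl⟩
  | tail _ h ih =>
    have := hN.step hd he ih.1 h
    exact ⟨this.1, ih.2.trans this.2⟩

/-- Both sides equal the value of `N` after both descents have been replaced. The differences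
contain one reduct and one relator; expanding the reduct into words leaves relators whose leading
word is below the original one. -/
theorem KillsBelow.disjoint {u s v : List σ} {j i l k : σ} (hij : i < j) (hkl : k < l)
    (hN : KillsBelow m d N (u ++ [j, i] ++ s ++ [l, k] ++ v)) :
    N (word u * reduct d i j * word (s ++ [l, k] ++ v)) =
      N (word (u ++ [j, i] ++ s) * reduct d k l * word v) := by
  have h1 : N (word u * reduct d i j * word s * relator d k l * word v) = 0 := by
    have hmem := reduct_mem_span (hd i j hij) hij
    generalize reduct d i j = p at hmem
    induction hmem using Submodule.span_induction with
    | mem p h =>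
      obtain ⟨t, ht, rfl⟩ := h
      have := hN (u ++ t ++ s) l k v hkl (by simpa using ht u (s ++ [l, k] ++ v))
      simpa only [word_append] using this
    | zero => simp
    | add a b _ _ ha hb => simp only [mul_add, add_mul, map_add, ha, hb, add_zero]
    | smul c a _ h => simp only [mul_smul_comm, smul_mul_assoc, map_smul, h, smul_zero]
  have h2 : N (word u * relator d i j * word s * reduct d k l * word v) = 0 := by
    have hmem := reduct_mem_span (hd k l hkl) hkl
    generalize reduct d k l = p at hmem
    induction hmem using Submodule.span_induction with
    | mem p h =>
      obtain ⟨t, ht, rfl⟩ := h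
      have := hN u j i (s ++ t ++ v) hij (by simpa using ht (u ++ [j, i] ++ s) v)
      simpa only [word_append, mul_assoc] using this
    | zero => simp
    | add a b _ _ ha hb => simp only [mul_add, add_mul, map_add, ha, hb, add_zero]
    | smul c a _ h => simp only [mul_smul_comm, smul_mul_assoc, map_smul, h, smul_zero]
  simp only [word_append, ← reduct_add_relator d, mul_add, add_mul, map_add, ← mul_assoc]
  rw [h1, h2, add_zero]

-- The two ways of rewriting `x_k x_j x_i` differ by relators with leading words `x_j x_k x_i`, `x_j
-- x_i x_k`, `x_k x_i x_j`, `x_i x_k x_j`, all below `x_k x_j x_i`, and by the expression of the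
-- non-degeneracy condition.
omit hd in
theorem overlap_identity (i j k : σ) :
    reduct d j k * FreeAlgebra.ι K i - FreeAlgebra.ι K k * reduct d i j =
      FreeAlgebra.ι K j * relator d i k + relator d i j * FreeAlgebra.ι K k
        - relator d i k * FreeAlgebra.ι K j - FreeAlgebra.ι K i * relator d j k
        + (freeD d i j * FreeAlgebra.ι K k - FreeAlgebra.ι K k * freeD d i j
          + FreeAlgebra.ι K j * freeD d i k - freeD d i k * FreeAlgebra.ι K j
          + freeD d j k * FreeAlgebra.ι K i - FreeAlgebra.ι K i * freeD d j k) := by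
  simp only [reduct, relator]
  noncomm_ring

theorem overlap_mem_lowSpan {i j k : σ} (hij : i < j) (hjk : j < k) :
    freeD d i j * FreeAlgebra.ι K k - FreeAlgebra.ι K k * freeD d i j
      + FreeAlgebra.ι K j * freeD d i k - freeD d i k * FreeAlgebra.ι K j
      + freeD d j k * FreeAlgebra.ι K i - FreeAlgebra.ι K i * freeD d j k ∈
    lowSpan K m (wexp [k, j, i]) := by
  have hL : ∀ a b c : σ, b < c → wexp [k, j, i] = Finsupp.single a 1 + (Finsupp.single b 1 +
      Finsupp.single c 1) → FreeAlgebra.ι K a * freeD d b c ∈ lowSpan K m (wexp [k, j, i]) := by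
    intro a b c hbc he
    have := word_mul_mul_mem_lowSpan (freeD_mem_lowSpan (hd b c hbc)) [a] []
    simpa [word_cons, wexp_cons, he] using this
  have hR : ∀ a b c : σ, b < c → wexp [k, j, i] = Finsupp.single a 1 + (Finsupp.single b 1 +
      Finsupp.single c 1) → freeD d b c * FreeAlgebra.ι K a ∈ lowSpan K m (wexp [k, j, i]) := by
    intro a b c hbc he
    have := word_mul_mul_mem_lowSpan (freeD_mem_lowSpan (hd b c hbc)) [] [a]
    rw [he, add_comm]
    simpa [word_cons, wexp_cons] using this
  have e1 : wexp [k, j, i] = Finsupp.single k 1 + (Finsupp.single i 1 + Finsupp.single j 1) := by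
    simp only [wexp_cons, wexp_nil]; abel
  have e2 : wexp [k, j, i] = Finsupp.single j 1 + (Finsupp.single i 1 + Finsupp.single k 1) := by
    simp only [wexp_cons, wexp_nil]; abel
  have e3 : wexp [k, j, i] = Finsupp.single i 1 + (Finsupp.single j 1 + Finsupp.single k 1) := by
    simp only [wexp_cons, wexp_nil]; abel
  exact Submodule.sub_mem _ (Submodule.add_mem _ (Submodule.sub_mem _ (Submodule.add_mem _
    (Submodule.sub_mem _ (hR k i j hij e1) (hL k i j hij e1)) (hL j i k (hij.trans hjk) e2))
    (hR j i k (hij.trans hjk) e2)) (hR i j k hjk e3)) (hL i j k hjk e3)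

theorem KillsBelow.overlap (hnd : Nondegenerate d) {u v : List σ} {i j k : σ} (hij : i < j)
    (hjk : j < k) (hN : KillsBelow m d N (u ++ [k, j, i] ++ v)) :
    N (word u * reduct d j k * word (i :: v)) =
      N (word (u ++ [k]) * reduct d i j * word v) := by
  have hik := hij.trans hjk
  have h0 := hN.of_reduces hd (u := u) (v := v) (e := wexp [k, j, i])
    (by simp only [wexp_append]) (overlap_mem_lowSpan hd hij hjk) (hnd i j k hij hjk)
  have h1 := hN (u ++ [j]) k i v hik (by simpa using WordLT.swap hjk u (i :: v))
  have h2 := hN u j i (k :: v) hij (by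
    have a := WordLT.swap (m := m) hik (u ++ [j]) v
    have b := WordLT.swap (m := m) hjk u (i :: v)
    simp only [List.append_assoc, List.cons_append, List.nil_append] at a b ⊢
    exact a.trans b)
  have h3 := hN u k i (j :: v) hik (by simpa using WordLT.swap hij (u ++ [k]) v)
  have h4 := hN (u ++ [i]) k j v hjk (by
    have a := WordLT.swap (m := m) hik u (j :: v)
    have b := WordLT.swap (m := m) hij (u ++ [k]) v
    simp only [List.append_assoc, List.cons_append, List.nil_append] at a b ⊢
    exact a.trans b)
  rw [← sub_eq_zero, ← map_sub]
  have hid := overlap_identity (d := d) i j k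
  have key : word u * reduct d j k * word (i :: v) - word (u ++ [k]) * reduct d i j * word v =
      word u * (reduct d j k * FreeAlgebra.ι K i - FreeAlgebra.ι K k * reduct d i j) * word v := by
    simp only [word_append, word_cons, word_nil, mul_one, mul_sub, sub_mul, mul_assoc]
  simp only [word_append, word_cons, word_nil, mul_one, mul_assoc] at h1 h2 h3 h4
  rw [key, hid, mul_add, add_mul, map_add, h0, add_zero]
  simp only [mul_sub, sub_mul, mul_add, add_mul, map_sub, map_add, mul_assoc, h1, h2, h3, h4,
    add_zero, sub_zero]

/-- The result of replacing a descent, normalized, does not depend on the descent. -/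
theorem KillsBelow.confluent (hnd : Nondegenerate d) (hN : KillsBelow m d N w)
    {u v u' v' : List σ} {i j k l : σ} (hij : i < j) (hkl : k < l) (h : w = u ++ j :: i :: v)
    (h' : w = u' ++ l :: k :: v') :
    N (word u * reduct d i j * word v) = N (word u' * reduct d k l * word v') := by
  -- By symmetry the first descent starts no later than the second. The offset `as` has length 0
  -- (same descent), 1 (overlap in three letters) or at least 2 (disjoint descents).
  wlog H : ∃ as, u' = u ++ as ∧ j :: i :: v = as ++ l :: k :: v' generalizing u v u' v' i j k l
  · refine (this hkl hij h' h ?_).symm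
    rcases List.append_eq_append_iff.mp (h.symm.trans h') with h1 | ⟨bs, h1, h2⟩
    · exact absurd h1 H
    · exact ⟨bs, h1, h2⟩
  obtain ⟨as, rfl, H⟩ := H
  match as with
  | [] =>
    simp only [List.nil_append, List.cons.injEq] at H
    obtain ⟨rfl, rfl, rfl⟩ := H
    rw [List.append_nil]
  | [a] =>
    simp only [List.cons_append, List.nil_append, List.cons.injEq] at H
    obtain ⟨rfl, rfl, rfl⟩ := H
    subst h
    exact KillsBelow.overlap hd hnd hkl hij (by simpa using hN)
  | a :: b :: s =>
    simp only [List.cons_append, List.cons.injEq] at H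
    obtain ⟨rfl, rfl, rfl⟩ := H
    subst h
    have := KillsBelow.disjoint hd hij hkl (u := u) (s := s) (v := v') (N := N)
      (by simpa using hN)
    simpa using this

theorem normalForm_relator (hnd : Nondegenerate d) (u v : List σ) {i j : σ} (hij : i < j) :
    normalForm m d (word u * relator d i j * word v) = 0 := by
  suffices H : ∀ w, ∀ u j i v, i < j → w = u ++ j :: i :: v →
      normalForm m d (word u * relator d i j * word v) = 0 from H _ u j i v hij rfl
  intro w
  induction w using (wordLT_wf m).induction with
  | _ w ih =>
  intro u j i v hij hw
  have hN : KillsBelow m d (normalForm m d) w := fun u j i v hij h => ih _ h u j i v hij rfl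
  obtain ⟨u', j', i', v', hij', hw', h⟩ := exists_normalForm_eq hd
    (w := w) ⟨(u, j, i, v), hij, hw⟩
  -- The recursion used one chosen descent; confluence replaces it by the given one.
  rw [← hN.confluent hd hnd hij hij' hw hw'] at h
  rw [hw, show u ++ j :: i :: v = u ++ [j, i] ++ v by simp, word_append, word_append,
    ← reduct_add_relator d, mul_add, add_mul, map_add] at h
  simpa using h

/-- The elements `p` such that the normal forms of all the multiples of `p` are zero. -/
noncomputable def normalIdeal (m : MonomialOrder.{0, 0} σ) (d : σ → σ → MvPolynomial σ K) :
    TwoSidedIdeal (FreeAlgebra K σ) :=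
  TwoSidedIdeal.mk' {p | ∀ a b, normalForm m d (a * p * b) = 0}
    (fun a b => by simp)
    (fun {x y} hx hy a b => by rw [mul_add, add_mul, map_add, hx, hy, add_zero])
    (fun {x} hx a b => by rw [mul_neg, neg_mul, map_neg, hx, neg_zero])
    (fun {x y} hy a b => by rw [← mul_assoc, hy])
    (fun {x y} hx a b => by rw [← mul_assoc, mul_assoc, hx])

omit hd in
theorem mem_normalIdeal {p : FreeAlgebra K σ} :
    p ∈ normalIdeal m d ↔ ∀ a b, normalForm m d (a * p * b) = 0 :=
  TwoSidedIdeal.mem_mk' _ _ _ _ _ _ _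

theorem relator_mem_normalIdeal (hnd : Nondegenerate d) {i j : σ} (hij : i < j) :
    relator d i j ∈ normalIdeal m d := by
  rw [mem_normalIdeal]
  intro a b
  have ha : a ∈ Submodule.span K (Set.range (word : List σ → FreeAlgebra K σ)) := by
    rw [span_word]; trivial
  have hb : b ∈ Submodule.span K (Set.range (word : List σ → FreeAlgebra K σ)) := by
    rw [span_word]; trivial
  induction ha using Submodule.span_induction with
  | mem a ha =>
    obtain ⟨u, rfl⟩ := ha
    induction hb using Submodule.span_induction with
    | mem b hb =>
      obtain ⟨v, rfl⟩ := hb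
      exact normalForm_relator hd hnd u v hij
    | zero => simp
    | add a b _ _ ha hb => rw [mul_add, map_add, ha, hb, add_zero]
    | smul c a _ h => rw [mul_smul_comm, map_smul, h, smul_zero]
  | zero => simp
  | add a b _ _ ha hb => rw [add_mul, add_mul, map_add, ha, hb, add_zero]
  | smul c a _ h => rw [smul_mul_assoc, smul_mul_assoc, map_smul, h, smul_zero]

/-- Since the relators lie in `normalIdeal`, the quotient by it receives a map from `GAlg d`. So `p`
lies in this ideal, and its multiple `1 * p * 1` has normal form zero. -/
theorem normalForm_eq_zero_of_mk (hnd : Nondegenerate d) {p : FreeAlgebra K σ}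
    (hp : GAlg.mk d p = 0) : normalForm m d p = 0 := by
  let f : RingQuot (GRel d) →+* (normalIdeal m d).ringCon.Quotient :=
    RingQuot.lift ⟨(normalIdeal m d).ringCon.mk', fun x y h => by
      obtain ⟨i, j, hij⟩ := h
      refine (RingCon.eq _).mpr ((TwoSidedIdeal.rel_iff _ _ _).mpr ?_)
      rw [← sub_sub]
      exact relator_mem_normalIdeal hd hnd hij⟩
  have h : f (RingQuot.mkRingHom (GRel d) p) = (normalIdeal m d).ringCon.mk' p :=
    RingQuot.lift_mkRingHom_apply _ _ _
  rw [← RingQuot.mkAlgHom_coe K, RingHom.coe_coe, show RingQuot.mkAlgHom K (GRel d) p = 0 from hp,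
    map_zero] at h
  have h' := (RingCon.eq _).mp h.symm
  have := mem_normalIdeal.mp ((TwoSidedIdeal.mem_iff _ _).mpr h') 1 1
  simpa using this

/-- In a G-algebra of Lie type the standard monomials are linearly independent. -/
theorem stdEval_gen_eq_zero (hnd : Nondegenerate d) {p : MvPolynomial σ K}
    (hp : stdEval (GAlg.gen d) p = 0) : p = 0 := by
  have h1 : stdEval (GAlg.gen d) p = GAlg.mk d (stdEval (FreeAlgebra.ι K) p) := by
    rw [stdEval, stdEval, map_sum]
    refine Finset.sum_congr rfl fun α _ => ?_
    rw [map_smul, stdMon_eq_prod, stdMon_eq_prod, map_list_prod, List.map_map]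
    rfl
  have h2 := normalForm_eq_zero_of_mk hd hnd (h1 ▸ hp)
  rw [stdEval, map_sum] at h2
  rw [p.as_sum, ← h2]
  refine Finset.sum_congr rfl fun α _ => ?_
  rw [map_smul, stdMon_ι, normalForm_word_of_pairwise m d (pairwise_stdWord α), wexp_stdWord,
    MvPolynomial.smul_monomial, smul_eq_mul, mul_one]

end Confluence

end GLie

namespace GLie

/-! ### Standard monomials, leading terms and left Gröbner bases. -/

section StandardMonomials

variable {K : Type*} [Field K] {σ : Type} [Fintype σ] [LinearOrder σ]
  {R : Type*} [Ring R] [Algebra K R] (v : σ → R)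

/-- `stdEval` as a linear map. -/
noncomputable def stdEvalLinear (K : Type*) [Field K] [Algebra K R] :
    MvPolynomial σ K →ₗ[K] R :=
  (MvPolynomial.basisMonomials σ K).constr K (stdMon v)

theorem stdEvalLinear_apply (p : MvPolynomial σ K) : stdEvalLinear v K p = stdEval v p := by
  rw [stdEvalLinear, Module.Basis.constr_apply]
  rfl

theorem stdEvalLinear_monomial (α : σ →₀ ℕ) (c : K) :
    stdEvalLinear v K (MvPolynomial.monomial α c) = c • stdMon v α := by
  have h := (MvPolynomial.basisMonomials σ K).constr_basis K (stdMon v) α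
  rw [show MvPolynomial.monomial α c = c • MvPolynomial.monomial α (1 : K) by
    rw [MvPolynomial.smul_monomial, smul_eq_mul, mul_one], map_smul]
  exact congrArg (c • ·) h

variable {v}

theorem map_stdMon {S F : Type*} [Ring S] [Algebra K S] [FunLike F R S] [AlgHomClass F K R S]
    (f : F) (α : σ →₀ ℕ) : f (stdMon v α) = stdMon (fun i => f (v i)) α := by
  rw [stdMon_eq_prod, stdMon_eq_prod, map_list_prod, List.map_map]
  rfl

theorem map_stdEval {S F : Type*} [Ring S] [Algebra K S] [FunLike F R S] [AlgHomClass F K R S]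
    (f : F) (p : MvPolynomial σ K) : f (stdEval v p) = stdEval (fun i => f (v i)) p := by
  rw [stdEval, stdEval, map_sum]
  refine Finset.sum_congr rfl fun α _ => ?_
  rw [map_smul, map_stdMon (K := K)]

theorem exists_of_mem_span_stdMon {T : Set (σ →₀ ℕ)} {x : R}
    (hx : x ∈ Submodule.span K (stdMon v '' T)) :
    ∃ p : MvPolynomial σ K, stdEval v p = x ∧ ∀ α ∈ p.support, α ∈ T := by
  simp only [← stdEvalLinear_apply]
  induction hx using Submodule.span_induction with
  | mem x h =>
    obtain ⟨α, hα, rfl⟩ := h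
    refine ⟨MvPolynomial.monomial α 1, by rw [stdEvalLinear_monomial, one_smul], fun β hβ => ?_⟩
    rwa [Finset.mem_singleton.mp (MvPolynomial.support_monomial_subset hβ)]
  | zero => exact ⟨0, map_zero _, by simp⟩
  | add x y _ _ hx hy =>
    classical
    obtain ⟨p, rfl, hp⟩ := hx
    obtain ⟨q, rfl, hq⟩ := hy
    refine ⟨p + q, map_add _ _ _, fun α hα => ?_⟩
    exact (Finset.mem_union.mp (MvPolynomial.support_add hα)).elim (hp α) (hq α)
  | smul c x _ hx =>
    obtain ⟨p, rfl, hp⟩ := hx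
    exact ⟨c • p, map_smul _ _ _, fun α hα => hp α (MvPolynomial.support_smul hα)⟩

variable {m : MonomialOrder.{0, 0} σ} {d : σ → σ → MvPolynomial σ K}

/-- A product of generators is the standard monomial with the same exponent vector, up to smaller
standard monomials. -/
theorem prod_sub_stdMon_mem
    (hd : ∀ i j : σ, i < j → m.degree (d i j) ≺[m] Finsupp.single i 1 + Finsupp.single j 1)
    (hv : ∀ i j : σ, i < j → v j * v i = v i * v j + stdEval v (d i j)) (w : List σ) :
    (w.map v).prod - stdMon v (wexp w) ∈
      Submodule.span K (stdMon v '' {α | α ≺[m] wexp w}) := by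
  induction w using (wordLT_wf m).induction with
  | _ w ih =>
  by_cases h : ∀ u j i v, i < j → w ≠ u ++ j :: i :: v
  · rw [stdMon_eq_prod, ← eq_stdWord_of_pairwise (pairwise_of_no_descent w h), sub_self]
    exact Submodule.zero_mem _
  push Not at h
  obtain ⟨u, j, i, u', hij, rfl⟩ := h
  have he : wexp (u ++ j :: i :: u') = wexp (u ++ i :: j :: u') := by
    simp only [wexp_append, wexp_cons]; abel
  have h1 := ih _ (WordLT.swap hij u u')
  have h2 : ((u ++ j :: i :: u').map v).prod = ((u ++ i :: j :: u').map v).prod +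
      (u.map v).prod * stdEval v (d i j) * (u'.map v).prod := by
    simp only [List.map_append, List.map_cons, List.prod_append, List.prod_cons]
    rw [← mul_assoc (v j), hv i j hij]
    noncomm_ring
  rw [h2, he, add_sub_right_comm]
  refine Submodule.add_mem _ h1 ?_
  rw [stdEval, Finset.mul_sum, Finset.sum_mul]
  refine Submodule.sum_mem _ fun α hα => ?_
  rw [mul_smul_comm, smul_mul_assoc]
  refine Submodule.smul_mem _ _ ?_
  have hα' : wexp (stdWord α) ≺[m] wexp [j, i] := by
    rw [wexp_pair, wexp_stdWord]; exact (m.le_degree hα).trans_lt (hd i j hij)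
  have h3 := ih (u ++ stdWord α ++ u') (by simpa using WordLT.of_middle hα' u u')
  have h4 : wexp (u ++ stdWord α ++ u') ≺[m] wexp (u ++ i :: j :: u') := by
    rw [← he, show u ++ j :: i :: u' = u ++ [j, i] ++ u' by simp]
    simp only [wexp_append _ u', wexp_append u, map_add]
    gcongr
  have h5 : (u.map v).prod * stdMon v α * (u'.map v).prod =
      ((u ++ stdWord α ++ u').map v).prod := by
    simp [stdMon_eq_prod, mul_assoc]
  rw [h5, ← sub_add_cancel (List.prod _) (stdMon v (wexp (u ++ stdWord α ++ u')))]
  refine Submodule.add_mem _ (Submodule.span_mono (Set.image_mono fun β hβ => ?_) h3)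
    (Submodule.subset_span ⟨_, h4, rfl⟩)
  exact lt_trans hβ h4

theorem exists_stdEval_eq
    (hd : ∀ i j : σ, i < j → m.degree (d i j) ≺[m] Finsupp.single i 1 + Finsupp.single j 1)
    (hv : ∀ i j : σ, i < j → v j * v i = v i * v j + stdEval v (d i j))
    (hgen : Algebra.adjoin K (Set.range v) = ⊤) (x : R) :
    ∃ p : MvPolynomial σ K, stdEval v p = x := by
  have hx : x ∈ Algebra.adjoin K (Set.range v) := hgen ▸ Algebra.mem_top
  rw [Algebra.adjoin_range_eq_range_freeAlgebra_lift] at hx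
  obtain ⟨q, rfl⟩ := hx
  have hq : q ∈ Submodule.span K (Set.range (word : List σ → FreeAlgebra K σ)) := by
    rw [span_word]; trivial
  suffices H : FreeAlgebra.lift K v q ∈ Submodule.span K (stdMon v '' Set.univ) by
    obtain ⟨p, hp, -⟩ := exists_of_mem_span_stdMon H
    exact ⟨p, hp⟩
  induction hq using Submodule.span_induction with
  | mem q h =>
    obtain ⟨w, rfl⟩ := h
    have h : FreeAlgebra.lift K v (word w) = (w.map v).prod := by
      rw [word, map_list_prod, List.map_map]
      congr 2
      ext i
      simp
    rw [h, ← sub_add_cancel (List.prod _) (stdMon v (wexp w))]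
    exact Submodule.add_mem _ (Submodule.span_mono (Set.image_mono (Set.subset_univ _))
      (prod_sub_stdMon_mem hd hv w)) (Submodule.subset_span ⟨_, trivial, rfl⟩)
  | zero => rw [map_zero]; exact Submodule.zero_mem _
  | add a b _ _ ha hb => rw [map_add]; exact Submodule.add_mem _ ha hb
  | smul c a _ h => rw [map_smul]; exact Submodule.smul_mem _ _ h

theorem stdEval_sub_leading_mem (p : MvPolynomial σ K) :
    stdEval v p - m.leadingCoeff p • stdMon v (m.degree p) ∈
      Submodule.span K (stdMon v '' {α | α ≺[m] m.degree p}) := by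
  classical
  by_cases hp : p = 0
  · subst hp
    simp [stdEval]
  rw [stdEval, ← Finset.add_sum_erase _ _ (m.degree_mem_support hp), MonomialOrder.leadingCoeff,
    add_sub_cancel_left]
  refine Submodule.sum_mem _ fun α hα => Submodule.smul_mem _ _ (Submodule.subset_span
    ⟨α, ?_, rfl⟩)
  rw [Finset.mem_erase] at hα
  exact lt_of_le_of_ne (m.le_degree hα.2) (m.toSyn.injective.ne hα.1)

/-- Leading exponents add under left multiplication by a monomial, and the leading coefficient is
kept, because the commutation relations only create smaller terms. -/
theorem stdMon_mul_sub_mem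
    (hd : ∀ i j : σ, i < j → m.degree (d i j) ≺[m] Finsupp.single i 1 + Finsupp.single j 1)
    (hv : ∀ i j : σ, i < j → v j * v i = v i * v j + stdEval v (d i j)) (γ : σ →₀ ℕ)
    (q : MvPolynomial σ K) :
    stdMon v γ * stdEval v q - m.leadingCoeff q • stdMon v (γ + m.degree q) ∈
      Submodule.span K (stdMon v '' {α | α ≺[m] γ + m.degree q}) := by
  have hmul : ∀ α, stdMon v γ * stdMon v α - stdMon v (γ + α) ∈
      Submodule.span K (stdMon v '' {β | β ≺[m] γ + α}) := by
    intro α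
    have h := prod_sub_stdMon_mem hd hv (stdWord γ ++ stdWord α)
    rw [List.map_append, List.prod_append, wexp_append, wexp_stdWord, wexp_stdWord,
      ← stdMon_eq_prod, ← stdMon_eq_prod] at h
    exact h
  have hlow : ∀ x ∈ Submodule.span K (stdMon v '' {α | α ≺[m] m.degree q}),
      stdMon v γ * x ∈ Submodule.span K (stdMon v '' {α | α ≺[m] γ + m.degree q}) := by
    intro x hx
    induction hx using Submodule.span_induction with
    | mem x h =>
      obtain ⟨α, hα, rfl⟩ := h
      have hlt : γ + α ≺[m] γ + m.degree q := by
        have hα : α ≺[m] m.degree q := hα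
        simp only [map_add]
        gcongr
      rw [← sub_add_cancel (stdMon v γ * stdMon v α) (stdMon v (γ + α))]
      exact Submodule.add_mem _ (Submodule.span_mono (Set.image_mono fun β hβ =>
        lt_trans hβ hlt) (hmul α)) (Submodule.subset_span ⟨_, hlt, rfl⟩)
    | zero => rw [mul_zero]; exact Submodule.zero_mem _
    | add a b _ _ ha hb => rw [mul_add]; exact Submodule.add_mem _ ha hb
    | smul c a _ h => rw [mul_smul_comm]; exact Submodule.smul_mem _ _ h
  have h := Submodule.add_mem _ (hlow _ (stdEval_sub_leading_mem (v := v) (m := m) q))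
    (Submodule.smul_mem _ (m.leadingCoeff q) (hmul (m.degree q)))
  rwa [mul_sub, mul_smul_comm, smul_sub, sub_add_sub_cancel] at h

/-- A left Gröbner basis of a left ideal generates it. -/
theorem IsLeftGroebnerBasis.span_eq
    (hd : ∀ i j : σ, i < j → m.degree (d i j) ≺[m] Finsupp.single i 1 + Finsupp.single j 1)
    (hv : ∀ i j : σ, i < j → v j * v i = v i * v j + stdEval v (d i j))
    (hgen : Algebra.adjoin K (Set.range v) = ⊤) {L : Ideal R} {G : Set R}
    (hG : IsLeftGroebnerBasis K m v L G) : Ideal.span G = L := by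
  refine le_antisymm (Ideal.span_le.mpr hG.1) fun x hx => ?_
  obtain ⟨p, rfl⟩ := exists_stdEval_eq hd hv hgen x
  -- Division by `G`, by induction on the leading monomial of a polynomial representing the element.
  -- The representation need not be unique, so linear independence plays no role.
  induction he : m.toSyn (m.degree p) using WellFoundedLT.induction generalizing p with
  | _ e ih =>
  subst he
  by_cases hp : p = 0
  · subst hp
    simp [stdEval]
  obtain ⟨q, hq, hqG, hqp⟩ := hG.2 p hp hx
  have hlc : m.leadingCoeff q ≠ 0 := m.leadingCoeff_ne_zero_iff.mpr hq
  obtain ⟨γ, hγ⟩ : ∃ γ, m.degree p = γ + m.degree q := by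
    obtain ⟨γ, hγ⟩ := exists_add_of_le hqp
    exact ⟨γ, hγ.trans (add_comm _ _)⟩
  have h1 := stdMon_mul_sub_mem hd hv γ q
  have h2 := stdEval_sub_leading_mem (v := v) (m := m) p
  rw [← hγ] at h1
  -- The scalar is chosen so that the leading terms cancel, leaving a remainder in smaller standard
  -- monomials.
  have h3 := Submodule.sub_mem _ h2
    (Submodule.smul_mem _ (m.leadingCoeff p * (m.leadingCoeff q)⁻¹) h1)
  rw [smul_sub, smul_smul, inv_mul_cancel_right₀ hlc, sub_sub_sub_cancel_right] at h3
  have hmem : (m.leadingCoeff p * (m.leadingCoeff q)⁻¹) • (stdMon v γ * stdEval v q) ∈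
      Ideal.span G := by
    rw [Algebra.smul_def]
    exact Ideal.mul_mem_left _ _ (Ideal.mul_mem_left _ _ (Ideal.subset_span hqG))
  obtain ⟨s, hs, hsupp⟩ := exists_of_mem_span_stdMon h3
  rw [← sub_add_cancel (stdEval v p)
    ((m.leadingCoeff p * (m.leadingCoeff q)⁻¹) • (stdMon v γ * stdEval v q)), ← hs]
  refine Submodule.add_mem _ ?_ hmem
  by_cases hs0 : s = 0
  · subst hs0
    simp [stdEval]
  refine ih _ (hsupp _ (m.degree_mem_support hs0)) s ?_ rfl
  rw [hs]
  exact Submodule.sub_mem _ hx (Ideal.span_le.mpr hG.1 hmem)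

omit [LinearOrder σ] in
/-- Dickson's lemma. -/
theorem exists_finset_dominating (T : Set (σ →₀ ℕ)) :
    ∃ S : Finset (σ →₀ ℕ), (S : Set (σ →₀ ℕ)) ⊆ T ∧ ∀ a ∈ T, ∃ b ∈ S, b ≤ a := by
  have hfin : {a | Minimal (· ∈ T) a}.Finite :=
    WellQuasiOrderedLE.finite_of_isAntichain (setOfPred_minimal_antichain _)
  refine ⟨hfin.toFinset, fun a ha => ((Set.Finite.mem_toFinset _).mp ha).1, fun a ha => ?_⟩
  obtain ⟨b, hb, hb'⟩ := exists_minimal_le_of_wellFoundedLT (· ∈ T) a ha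
  exact ⟨b, (Set.Finite.mem_toFinset _).mpr hb', hb⟩

-- Dickson's lemma gives finitely many leading exponents of `L` dominating all others; one element
-- of `L` is chosen for each.
variable (v) in
theorem exists_finite_groebnerBasis (m : MonomialOrder.{0, 0} σ) (L : Ideal R) :
    ∃ G : Finset R, IsLeftGroebnerBasis K m v L (G : Set R) := by
  classical
  obtain ⟨S, hS, hS'⟩ := exists_finset_dominating
    {a | ∃ p : MvPolynomial σ K, p ≠ 0 ∧ stdEval v p ∈ L ∧ m.degree p = a}
  have hS : ∀ a, a ∈ S → ∃ p : MvPolynomial σ K, p ≠ 0 ∧ stdEval v p ∈ L ∧ m.degree p = a :=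
    fun a ha => hS ha
  choose! f hf using hS
  refine ⟨S.image fun a => stdEval v (f a), ?_, fun p hp hpL => ?_⟩
  · intro x hx
    obtain ⟨a, ha, rfl⟩ := Finset.mem_image.mp (Finset.mem_coe.mp hx)
    exact (hf a ha).2.1
  · obtain ⟨b, hb, hbp⟩ := hS' _ ⟨p, hp, hpL, rfl⟩
    exact ⟨f b, (hf b hb).1, Finset.mem_coe.mpr (Finset.mem_image_of_mem _ hb),
      (hf b hb).2.2.trans_le hbp⟩

theorem GAlg.gen_mul_gen (d : σ → σ → MvPolynomial σ K) {i j : σ} (h : i < j) :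
    GAlg.gen d j * GAlg.gen d i =
      GAlg.gen d i * GAlg.gen d j + stdEval (GAlg.gen d) (d i j) := by
  have h := RingQuot.mkAlgHom_rel K (GRel.comm (d := d) i j h)
  have h' : GAlg.mk d (FreeAlgebra.ι K j * FreeAlgebra.ι K i) =
    GAlg.mk d (FreeAlgebra.ι K i * FreeAlgebra.ι K j + freeD d i j) := h
  rw [map_mul, map_add, map_mul, map_stdEval] at h'
  exact h'

theorem IsGAlgebraOn.exists_relations (h : IsGAlgebraOn (K := K) m v) :
    ∃ d : σ → σ → MvPolynomial σ K,
      (∀ i j : σ, i < j → m.degree (d i j) ≺[m] Finsupp.single i 1 + Finsupp.single j 1) ∧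
      ∀ i j : σ, i < j → v j * v i = v i * v j + stdEval v (d i j) := by
  obtain ⟨d, hd, e, he⟩ := h
  refine ⟨d, hd.2, fun i j hij => ?_⟩
  have h := congrArg e (GAlg.gen_mul_gen d hij)
  rw [map_mul, map_add, map_mul, map_stdEval] at h
  simpa only [he] using h

theorem IsGAlgebraOn.eq_zero_of_stdEval (h : IsGAlgebraOn (K := K) m v) {p : MvPolynomial σ K}
    (hp : stdEval v p = 0) : p = 0 := by
  obtain ⟨d, hd, e, he⟩ := h
  refine stdEval_gen_eq_zero hd.2 hd.1 (e.injective ?_)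
  rw [map_stdEval, map_zero]
  simpa only [he] using hp

theorem IsGAlgebra.exists_stdEval_eq (hd : IsGAlgebra d) (x : GAlg d) :
    ∃ p : MvPolynomial σ K, stdEval (GAlg.gen d) p = x := by
  obtain ⟨m, hm⟩ := hd
  exact GLie.exists_stdEval_eq hm.2 (fun i j h => GAlg.gen_mul_gen d h) (GAlg.adjoin_gen d) x

end StandardMonomials

/-! ### Elimination of the second block of variables. -/

section LexSum

variable {α β : Type} [Fintype α] [LinearOrder α] [Fintype β] [LinearOrder β]

/-- This makes a standard monomial the product of its `α`-part and its `β`-part, in this order. -/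
theorem sort_univ_lexSum : (Finset.univ : Finset (α ⊕ₗ β)).sort (· ≤ ·) =
    ((Finset.univ : Finset α).sort (· ≤ ·)).map Sum.inlₗ ++
      ((Finset.univ : Finset β).sort (· ≤ ·)).map Sum.inrₗ := by
  refine List.Perm.eq_of_pairwise (le := (· ≤ ·)) (fun _ _ _ _ h h' => le_antisymm h h')
    (Finset.pairwise_sort _ _) ?_ ?_
  · rw [List.pairwise_append, List.pairwise_map, List.pairwise_map]
    refine ⟨(Finset.pairwise_sort _ _).imp fun h => Sum.Lex.inl_le_inl_iff.mpr h,
      (Finset.pairwise_sort _ _).imp fun h => Sum.Lex.inr_le_inr_iff.mpr h, ?_⟩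
    intro a ha b hb
    obtain ⟨a, -, rfl⟩ := List.mem_map.mp ha
    obtain ⟨b, -, rfl⟩ := List.mem_map.mp hb
    exact (Sum.Lex.inl_lt_inr a b).le
  · refine (List.perm_ext_iff_of_nodup (Finset.sort_nodup _ _) ?_).mpr fun s => ?_
    · refine List.nodup_append'.mpr ⟨(Finset.sort_nodup _ _).map
        (toLex.injective.comp Sum.inl_injective), (Finset.sort_nodup _ _).map
        (toLex.injective.comp Sum.inr_injective), ?_⟩
      intro s hs hs'
      obtain ⟨a, -, rfl⟩ := List.mem_map.mp hs
      obtain ⟨b, -, h⟩ := List.mem_map.mp hs'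
      exact Sum.inr_ne_inl (toLex.injective h)
    · obtain ⟨s, rfl⟩ := toLex.surjective s
      rcases s with a | b
      · simp only [Finset.mem_sort, Finset.mem_univ, List.mem_append, List.mem_map, true_and,
          true_iff]
        exact Or.inl ⟨a, rfl⟩
      · simp only [Finset.mem_sort, Finset.mem_univ, List.mem_append, List.mem_map, true_and,
          true_iff]
        exact Or.inr ⟨b, rfl⟩

theorem stdMon_lexSum {R : Type*} [Monoid R] (v : α ⊕ₗ β → R) (γ : (α ⊕ₗ β) →₀ ℕ)
    (a : α →₀ ℕ) (b : β →₀ ℕ) (ha : ∀ i, γ (Sum.inlₗ i) = a i) (hb : ∀ j, γ (Sum.inrₗ j) = b j) :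
    stdMon v γ = stdMon (fun i => v (Sum.inlₗ i)) a * stdMon (fun j => v (Sum.inrₗ j)) b := by
  simp only [stdMon, sort_univ_lexSum, List.map_append, List.prod_append, List.map_map,
    Function.comp_def, ha, hb]

omit [Fintype α] [LinearOrder α] [Fintype β] [LinearOrder β] in
theorem inlₗ_injective : Function.Injective (Sum.inlₗ : α → α ⊕ₗ β) :=
  toLex.injective.comp Sum.inl_injective

omit [Fintype α] [LinearOrder α] [Fintype β] [LinearOrder β] in
theorem mapDomain_inlₗ_inrₗ (a : α →₀ ℕ) (j : β) :
    a.mapDomain (Sum.inlₗ : α → α ⊕ₗ β) (Sum.inrₗ j) = 0 := by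
  refine Finsupp.mapDomain_of_notMem_range _ _ ?_
  rintro ⟨i, hi⟩
  exact Sum.inl_ne_inr (toLex.injective hi)

variable {K : Type*} [Field K] {R : Type*} [Ring R] [Algebra K R]

theorem stdEval_rename_inlₗ (v : α ⊕ₗ β → R) (p : MvPolynomial α K) :
    stdEval v (MvPolynomial.rename Sum.inlₗ p) = stdEval (fun i => v (Sum.inlₗ i)) p := by
  rw [← stdEvalLinear_apply, ← stdEvalLinear_apply]
  conv_lhs => rw [p.as_sum]
  conv_rhs => rw [p.as_sum]
  rw [map_sum, map_sum, map_sum]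
  refine Finset.sum_congr rfl fun a _ => ?_
  rw [MvPolynomial.rename_monomial, stdEvalLinear_monomial, stdEvalLinear_monomial,
    stdMon_lexSum v _ a 0 (fun i => Finsupp.mapDomain_apply inlₗ_injective _ _)
      (fun j => mapDomain_inlₗ_inrₗ a j)]
  simp [stdMon]

omit [Fintype α] [LinearOrder α] [Fintype β] [LinearOrder β] in
theorem degree_rename_inlₗ (m : MonomialOrder.{0, 0} (α ⊕ₗ β)) (p : MvPolynomial α K) :
    m.degree (MvPolynomial.rename Sum.inlₗ p) =
      ((restrictLeft m).degree p).mapDomain Sum.inlₗ := by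
  classical
  by_cases hp : p = 0
  · subst hp
    simp
  have hsupp := MvPolynomial.support_rename_of_injective (p := p) (inlₗ_injective (α := α) (β := β))
  have hp' : MvPolynomial.rename (Sum.inlₗ : α → α ⊕ₗ β) p ≠ 0 :=
    (map_ne_zero_iff _ (MvPolynomial.rename_injective _ inlₗ_injective)).mpr hp
  refine m.toSyn.injective (le_antisymm ?_ (m.le_degree ?_))
  · have h := m.degree_mem_support hp'
    rw [hsupp] at h
    obtain ⟨a, ha, ha'⟩ := Finset.mem_image.mp h
    rw [← ha']
    exact not_lt.mp fun hlt => ((restrictLeft m).le_degree ha).not_gt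
      ((restrictLeft_lt_iff m _ _).mpr hlt)
  · rw [hsupp]
    exact Finset.mem_image_of_mem _ ((restrictLeft m).degree_mem_support hp)

omit [Fintype α] [LinearOrder α] [Fintype β] [LinearOrder β] in
/-- With respect to an elimination ordering, a polynomial whose leading monomial does not involve
the variables `β` does not involve them at all. -/
theorem IsEliminationOrder.exists_rename_eq {m : MonomialOrder.{0, 0} (α ⊕ₗ β)}
    (hm : IsEliminationOrder m) {q : MvPolynomial (α ⊕ₗ β) K}
    (hq : ∀ j : β, m.degree q (Sum.inrₗ j) = 0) :
    ∃ p : MvPolynomial α K, MvPolynomial.rename Sum.inlₗ p = q := by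
  refine MvPolynomial.exists_rename_eq_of_vars_subset_range q _ inlₗ_injective fun s hs => ?_
  obtain ⟨s, rfl⟩ := toLex.surjective s
  rcases s with i | j
  · exact ⟨i, rfl⟩
  · obtain ⟨b, hb, hbj⟩ := (MvPolynomial.mem_vars_iff_mem_support _).mp (Finset.mem_coe.mp hs)
    exact absurd (hm _ b hq ⟨j, Finsupp.mem_support_iff.mp hbj⟩) (m.le_degree hb).not_gt

omit [Fintype α] [LinearOrder α] [Fintype β] [LinearOrder β] in
theorem IsEliminationOrder.eq_zero_of_lt {m : MonomialOrder.{0, 0} (α ⊕ₗ β)}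
    (hm : IsEliminationOrder m) {a b : (α ⊕ₗ β) →₀ ℕ} (ha : ∀ j : β, a (Sum.inrₗ j) = 0)
    (h : b ≺[m] a) (j : β) : b (Sum.inrₗ j) = 0 := by
  by_contra hb
  exact (hm a b ha ⟨j, hb⟩).not_gt h

variable {S : Type*} [Ring S] [Algebra K S] {v : α ⊕ₗ β → R} {x : α → S}

/-- The intersection of a left Gröbner basis with the subalgebra on the variables `α`, for an
elimination ordering. -/
theorem IsLeftGroebnerBasis.comap {m : MonomialOrder.{0, 0} (α ⊕ₗ β)} (hm : IsEliminationOrder m)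
    (f : S →ₐ[K] R) (hf : ∀ i, f (x i) = v (Sum.inlₗ i)) {L : Ideal R} {G : Set R}
    (hG : IsLeftGroebnerBasis K m v L G) :
    IsLeftGroebnerBasis K (restrictLeft m) x (Ideal.comap f L) (f ⁻¹' G) := by
  have hfx : ∀ p : MvPolynomial α K,
      f (stdEval x p) = stdEval v (MvPolynomial.rename Sum.inlₗ p) := fun p => by
    rw [map_stdEval, stdEval_rename_inlₗ]
    simp only [hf]
  refine ⟨fun a ha => hG.1 ha, fun p hp hpL => ?_⟩
  obtain ⟨q, hq, hqG, hqp⟩ := hG.2 (MvPolynomial.rename Sum.inlₗ p)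
    ((map_ne_zero_iff _ (MvPolynomial.rename_injective _ inlₗ_injective)).mpr hp)
    (by rw [← hfx]; exact hpL)
  rw [degree_rename_inlₗ] at hqp
  -- The leading monomial of `q` divides one free of `β`, hence is itself free of `β`, and
  -- elimination extends this to all of `q`.
  obtain ⟨q, rfl⟩ := hm.exists_rename_eq (q := q) fun j =>
    Nat.le_zero.mp ((hqp (Sum.inrₗ j)).trans_eq (mapDomain_inlₗ_inrₗ _ j))
  refine ⟨q, fun h => hq (by rw [h, map_zero]), ?_, fun i => ?_⟩
  · change f _ ∈ G
    rwa [hfx]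
  · have h := hqp (Sum.inlₗ i)
    rwa [degree_rename_inlₗ, Finsupp.mapDomain_apply inlₗ_injective,
      Finsupp.mapDomain_apply inlₗ_injective] at h

/-- For an elimination ordering, the commutation relations between the variables `α` do not
involve the variables `β`. -/
theorem IsEliminationOrder.exists_relations {m : MonomialOrder.{0, 0} (α ⊕ₗ β)}
    (hm : IsEliminationOrder m) (h : IsGAlgebraOn (K := K) m v)
    (f : S →ₐ[K] R) (hinj : Function.Injective f) (hf : ∀ i, f (x i) = v (Sum.inlₗ i)) :
    ∃ d : α → α → MvPolynomial α K,
      (∀ i j : α, i < j → (restrictLeft m).degree (d i j) ≺[restrictLeft m]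
        Finsupp.single i 1 + Finsupp.single j 1) ∧
      ∀ i j : α, i < j → x j * x i = x i * x j + stdEval x (d i j) := by
  obtain ⟨d, hd, hv⟩ := h.exists_relations
  have key : ∀ i j : α, i < j → ∃ q : MvPolynomial α K,
      MvPolynomial.rename Sum.inlₗ q = d (Sum.inlₗ i) (Sum.inlₗ j) := by
    intro i j hij
    refine hm.exists_rename_eq fun l => ?_
    -- The leading monomial of `d_ij` is below `x_i x_j`, which is free of `β`.
    refine hm.eq_zero_of_lt (fun l => ?_) (hd _ _ (Sum.Lex.inl_lt_inl_iff.mpr hij)) l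
    rw [Finsupp.add_apply, ← Finsupp.mapDomain_single (f := Sum.inlₗ) (a := i),
      ← Finsupp.mapDomain_single (f := Sum.inlₗ) (a := j), mapDomain_inlₗ_inrₗ,
      mapDomain_inlₗ_inrₗ]
  choose! q hq using key
  refine ⟨q, fun i j hij => ?_, fun i j hij => hinj ?_⟩
  · rw [restrictLeft_lt_iff, ← degree_rename_inlₗ, hq i j hij, Finsupp.mapDomain_add,
      Finsupp.mapDomain_single, Finsupp.mapDomain_single]
    exact hd _ _ (Sum.Lex.inl_lt_inl_iff.mpr hij)
  · rw [map_add, map_mul, map_mul, map_stdEval]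
    simp only [hf]
    rw [← stdEval_rename_inlₗ v, hq i j hij]
    exact hv _ _ (Sum.Lex.inl_lt_inl_iff.mpr hij)

end LexSum

/-! ### The embedding of `A` into `E'`. -/

section Embedding

variable {K : Type*} [Field K] {r n k : ℕ}
  {dC : Fin r → Fin r → MvPolynomial (Fin r) K}
  {dA : Fin n → Fin n → MvPolynomial (Fin n) K}
  {dB : Fin k → Fin k → MvPolynomial (Fin k) K}

theorem exists_stdEval_tgen_eq (hC : IsGAlgebra dC) (hA : IsGAlgebra dA)
    (a : GAlg dC ⊗[K] GAlg dA) :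
    ∃ p : MvPolynomial (Fin r ⊕ₗ Fin n) K, stdEval (tgen dC dA) p = a := by
  simp only [← stdEvalLinear_apply]
  change a ∈ LinearMap.range (stdEvalLinear (tgen dC dA) K)
  induction a using TensorProduct.induction_on with
  | zero => exact Submodule.zero_mem _
  | add a b ha hb => exact Submodule.add_mem _ ha hb
  | tmul c a =>
    obtain ⟨p, rfl⟩ := hC.exists_stdEval_eq c
    obtain ⟨q, rfl⟩ := hA.exists_stdEval_eq a
    rw [stdEval, stdEval, TensorProduct.sum_tmul]
    refine Submodule.sum_mem _ fun α _ => ?_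
    rw [TensorProduct.tmul_sum]
    refine Submodule.sum_mem _ fun β _ => ?_
    rw [TensorProduct.tmul_smul, ← TensorProduct.smul_tmul']
    refine Submodule.smul_mem _ _ (Submodule.smul_mem _ _ ⟨MvPolynomial.monomial (Finsupp.equivFunOnFinite.symm fun s => Sum.elim α β (ofLex s)) 1, ?_⟩)
    rw [stdEvalLinear_monomial, one_smul, stdMon_lexSum _ _ α β (fun i => rfl) (fun j => rfl)]
    have h1 := map_stdMon (K := K) (v := GAlg.gen dC)
      (Algebra.TensorProduct.includeLeft (R := K) (S := K) (A := GAlg dC) (B := GAlg dA)) α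
    have h2 := map_stdMon (K := K) (v := GAlg.gen dA)
      (Algebra.TensorProduct.includeRight (R := K) (A := GAlg dC) (B := GAlg dA)) β
    refine (congrArg₂ (· * ·) h1.symm h2.symm).trans ?_
    simp

/-- The structures on `C` and `A₁` serve only to write each element of `A` in standard monomials.
These become standard monomials of `E'`, where independence is known. -/
theorem inA'_injective (hC : IsGAlgebra dC) (hA : IsGAlgebra dA) (φ₁ : GAlg dA →ₐ[K] GAlg dB)
    {m : MonomialOrder.{0, 0} ((Fin r ⊕ₗ Fin n) ⊕ₗ Fin k)}
    (h : IsGAlgebraOn (K := K) m (genE' dC φ₁)) : Function.Injective (inA' dC φ₁) := by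
  refine (injective_iff_map_eq_zero _).mpr fun a ha => ?_
  obtain ⟨p, rfl⟩ := exists_stdEval_tgen_eq hC hA a
  rw [map_stdEval] at ha
  have hp := h.eq_zero_of_stdEval (p := MvPolynomial.rename Sum.inlₗ p)
    ((stdEval_rename_inlₗ _ p).trans ha)
  rw [(map_eq_zero_iff _ (MvPolynomial.rename_injective _ inlₗ_injective)).mp hp]
  simp [stdEval]

end Embedding

end GLie

open GLie in
theorem proposition2p3 {K : Type*} [Field K] [CharZero K] {r n k : ℕ}
    (dC : Fin r → Fin r → MvPolynomial (Fin r) K)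
    (dA : Fin n → Fin n → MvPolynomial (Fin n) K)
    (dB : Fin k → Fin k → MvPolynomial (Fin k) K)
    (hC : IsGAlgebra dC) (hA : IsGAlgebra dA) (hB : IsGAlgebra dB)
    (φ₁ : GAlg dA →ₐ[K] GAlg dB) :
    -- the inclusions `A ⊆ E' ⊆ E`
    (∀ a, jA dC φ₁ (inA' dC φ₁ a) = inA dC φ₁ a) ∧
    (∀ b, jB dC φ₁ (inB' dC φ₁ b) = inB dC φ₁ b) ∧
    Function.Injective (jA dC φ₁) ∧
    Function.Injective (jB dC φ₁) ∧
    ((∃ m, IsGAlgebraOn (K := K) m (genE' dC φ₁)) → Function.Injective (inA' dC φ₁)) ∧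
    ∀ J : Ideal (GAlg dC ⊗[K] GAlg dB),
      -- the first identity, for both embeddings of `E'` into `E`
      Ideal.comap (jB dC φ₁)
          (Ideal.span (jB dC φ₁ '' smallI dC φ₁) ⊔ Ideal.span (inB dC φ₁ '' J)) =
        smallIdeal dC φ₁ J ∧
      Ideal.comap (jA dC φ₁)
          (Ideal.span (jA dC φ₁ '' smallI dC φ₁) ⊔
            Ideal.span (jA dC φ₁ '' (inB' dC φ₁ '' J))) =
        smallIdeal dC φ₁ J ∧
      -- the same with the ideal generated by `I_φ` in `E`
      Ideal.comap (jB dC φ₁) (Ideal.span (bigI dC φ₁) ⊔ Ideal.span (inB dC φ₁ '' J)) =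
        smallIdeal dC φ₁ J ∧
      Ideal.comap (jA dC φ₁) (Ideal.span (bigI dC φ₁) ⊔ Ideal.span (inB dC φ₁ '' J)) =
        smallIdeal dC φ₁ J ∧
      -- the second identity
      Ideal.comap (bigHom dC φ₁) J = Ideal.comap (inA' dC φ₁) (smallIdeal dC φ₁ J) ∧
      -- the second intersection by means of Gröbner bases
      (∀ F : Set (GAlg dC ⊗[K] GAlg dB), Ideal.span F = J →
        smallIdeal dC φ₁ J =
          Ideal.span (Set.range (fun i : Fin n =>
              inA' dC φ₁ (1 ⊗ₜ[K] GAlg.gen dA i) -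
                inB' dC φ₁ (1 ⊗ₜ[K] φ₁ (GAlg.gen dA i))) ∪ inB' dC φ₁ '' F)) ∧
      ∀ m : MonomialOrder.{0, 0} ((Fin r ⊕ₗ Fin n) ⊕ₗ Fin k),
        IsEliminationOrder m → IsGAlgebraOn (K := K) m (genE' dC φ₁) →
        (∃ G : Finset (SmallE dC φ₁),
          IsLeftGroebnerBasis K m (genE' dC φ₁) (smallIdeal dC φ₁ J) (G : Set (SmallE dC φ₁))) ∧
        ∀ G : Set (SmallE dC φ₁),
          IsLeftGroebnerBasis K m (genE' dC φ₁) (smallIdeal dC φ₁ J) G →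
          IsLeftGroebnerBasis K (restrictLeft m) (tgen dC dA)
              (Ideal.comap (bigHom dC φ₁) J) (inA' dC φ₁ ⁻¹' G) ∧
            Ideal.span (inA' dC φ₁ ⁻¹' G) = Ideal.comap (bigHom dC φ₁) J := by
  refine ⟨jA_inA' dC φ₁, jB_inB' dC φ₁, Function.LeftInverse.injective (bigToSmall_jA dC φ₁),
    Function.LeftInverse.injective (bigToSmall_jB dC φ₁),
    fun ⟨m, h⟩ => inA'_injective hC hA φ₁ h, fun J => ⟨comap_jB_span_smallI dC φ₁ J,
    comap_jA_span_smallI dC φ₁ J, comap_jB_span_bigI dC φ₁ J, comap_jA_span_bigI dC φ₁ J,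
    comap_bigHom_eq dC φ₁ J, ?_, fun m hm h => ⟨exists_finite_groebnerBasis _ m _, fun G hG => ?_⟩⟩⟩
  · rintro F rfl
    rw [smallIdeal_eq]
    exact (span_smallDiff_union dC φ₁ F).symm
  · have hG' := hG.comap hm (inA' dC φ₁) (x := tgen dC dA) (fun i => rfl)
    rw [← comap_bigHom_eq] at hG'
    -- The orderings coming with `C` and `A₁` may be unrelated to `m`, so relations of `A`
    -- compatible with the restricted ordering are pulled back from `E'` along the injection.
    obtain ⟨d, hd, hv⟩ := hm.exists_relations h (inA' dC φ₁) (inA'_injective hC hA φ₁ h)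
      (x := tgen dC dA) (fun i => rfl)
    exact ⟨hG', hG'.span_eq hd hv (adjoin_tgen dC dA)⟩
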